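/- Let $p$ be a prime and let $G$ be a finite group. For $d \in \mathbb{N}$ let $\mathcal{F}(d)$ be the free pro-$p$-$G$ operator group of rank $d$, i.e. the free pro-$p$ group on the basis $x_{a,g}$, $1 \le a \le d$, $g \in G$, with the continuous action of $G$ given by $g' x_{a,g} = x_{a,g'g}$. For a pro-$p$ group $P$ let $\{P^i\}_{i\ge 1}$ be the descending $p$-central series, $P^1 = P$, $P^{i+1} = (P^i)^p[P^i,P]$, and let $\{P_i\}_{i\ge 1}$ be the descending central series, $P_1 = P$, $P_{i+1} = [P_i,P]$ (closed subgroups). For $\nu = (i,j)$ with $i \ge j \ge 1$ put $P^{(\nu)} = (P^i \cap P_j)P^{i+1}$, and let $\nu+1 = (i,j+1)$ if $i > j$ and $\nu+1 = (i+1,1)$ if $i = j$. Write $\mathcal{E}(d,\nu) = \mathcal{F}(d)^{(\nu)}/\mathcal{F}(d)^{(\nu+1)}$. This is an $\mathbb{F}_p$-vector space on which $\mathcal{F}(d)/\mathcal{F}(d)^{(\nu)} \rtimes G$ acts, the first factor by conjugation and $G$ through its action on $\mathcal{F}(d)$. Let $n, t \in \mathbb{N}$, a finitely generated $\mathbb{F}_p[G]$-module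 $T$ and $\nu = (i,j)$ with $i \ge j \ge 1$ be given. Let $\mathcal{F}(d)/\mathcal{F}(d)^{(\nu)} \rtimes G$ act on $T$ through its projection to $G$, and diagonally on $\mathcal{E}(d,\nu) \otimes_{\mathbb{F}_p} T$. Then there exists $m_0 \ge n$ such that for all $m \ge m_0$ the following hold. (i) For any given elements $$x_1,\dots,x_t \in H_1\bigl(\mathcal{F}(m)/\mathcal{F}(m)^{(\nu)} \rtimes G,\ \mathcal{E}(m,\nu) \otimes T\bigr)$$ there exists a surjective continuous $G$-equivariant homomorphism $\psi : \mathcal{F}(m) \twoheadrightarrow \mathcal{F}(n)$ such that the induced homomorphism $$\psi_* : H_1\bigl(\mathcal{F}(m)/\mathcal{F}(m)^{(\nu)} \rtimes G,\ \mathcal{E}(m,\nu) \otimes T\bigr) \longrightarrow H_1\bigl(\mathcal{F}(n)/\mathcal{F}(n)^{(\nu)} \rtimes G,\ \mathcal{E}(n,\nu) \otimes T\bigr)$$ maps $x_1,\dots,x_t$ to zero. (ii) For any given elements $$x_1,\dots,x_t \in H_1\bigl(\mathcal{F}(m)/\mathcal{F}(m)^{(\nu)},\ \mathcal{E}(m,\nu)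 \otimes T\bigr)$$ there exists a surjective continuous $G$-equivariant homomorphism $\psi : \mathcal{F}(m) \twoheadrightarrow \mathcal{F}(n)$ such that the induced homomorphism $$\psi_* : H_1\bigl(\mathcal{F}(m)/\mathcal{F}(m)^{(\nu)},\ \mathcal{E}(m,\nu) \otimes T\bigr) \longrightarrow H_1\bigl(\mathcal{F}(n)/\mathcal{F}(n)^{(\nu)},\ \mathcal{E}(n,\nu) \otimes T\bigr)$$ maps $x_1,\dots,x_t$ to zero. Here $H_1 = \hat H^{-2}$ is the first homology group of a finite group. -/

import Mathlib

open scoped TensorProduct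

/-! ## Pro-`p` completion of a discrete group -/

section ProP

/-- The normal subgroups of `Γ` whose index is a (finite) power of `p`. -/
abbrev PIndexSubgroup (p : ℕ) (Γ : Type) [Group Γ] : Type :=
  {N : Subgroup Γ // N.Normal ∧ ∃ k : ℕ, N.index = p ^ k}

instance PIndexSubgroup.instNormal {p : ℕ} {Γ : Type} [Group Γ] (N : PIndexSubgroup p Γ) :
    N.1.Normal := N.2.1

/-- The pullback of a normal subgroup of `p`-power index. -/
def PIndexSubgroup.comap {p : ℕ} [Fact p.Prime] {Γ Δ : Type} [Group Γ] [Group Δ] (f : Γ →* Δ)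
    (N : PIndexSubgroup p Δ) : PIndexSubgroup p Γ :=
  ⟨N.1.comap f, N.2.1.comap f, by
    obtain ⟨k, hk⟩ := N.2.2
    have h : (N.1.comap f).index ∣ p ^ k := by
      rw [Subgroup.index_comap, ← hk]
      exact Subgroup.relIndex_dvd_index_of_normal _ _
    obtain ⟨l, -, hl⟩ := (Nat.dvd_prime_pow Fact.out).1 h
    exact ⟨l, hl⟩⟩

/-- The compatible families in the product of all quotients of `p`-power order. -/
def proPCompatible (p : ℕ) (Γ : Type) [Group Γ] :
    Subgroup ((N : PIndexSubgroup p Γ) → Γ ⧸ N.1) where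
  carrier := {x | ∀ (N M : PIndexSubgroup p Γ) (h : N.1 ≤ M.1),
    QuotientGroup.map N.1 M.1 (MonoidHom.id Γ) h (x N) = x M}
  one_mem' := fun _ _ _ => map_one _
  mul_mem' := fun {x y} hx hy N M h => by
    rw [Pi.mul_apply, map_mul, hx N M h, hy N M h, Pi.mul_apply]
  inv_mem' := fun {x} hx N M h => by
    rw [Pi.inv_apply, map_inv, hx N M h, Pi.inv_apply]

/-- The pro-`p` completion of `Γ`: the inverse limit of its quotients of `p`-power order. -/
def ProPCompletion (p : ℕ) (Γ : Type) [Group Γ] : Type := proPCompatible p Γ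

namespace ProPCompletion

variable {p : ℕ} {Γ Δ Θ : Type} [Group Γ] [Group Δ] [Group Θ]

instance : Group (ProPCompletion p Γ) := inferInstanceAs (Group (proPCompatible p Γ))

/-- The projection to the quotient by `N`. -/
def proj (N : PIndexSubgroup p Γ) : ProPCompletion p Γ →* Γ ⧸ N.1 :=
  (Pi.evalMonoidHom (fun N : PIndexSubgroup p Γ => Γ ⧸ N.1) N).comp (proPCompatible p Γ).subtype

/-- The inverse limit topology: coarsest topology that makes the projections to the discrete
quotients continuous. -/
instance : TopologicalSpace (ProPCompletion p Γ) :=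
  ⨅ N : PIndexSubgroup p Γ, TopologicalSpace.induced (proj N) ⊥

instance : IsTopologicalGroup (ProPCompletion p Γ) :=
  topologicalGroup_iInf fun N =>
    letI : TopologicalSpace (Γ ⧸ N.1) := ⊥
    haveI : DiscreteTopology (Γ ⧸ N.1) := ⟨rfl⟩
    topologicalGroup_induced (proj N)

theorem ext {x y : ProPCompletion p Γ} (h : ∀ N, proj N x = proj N y) : x = y :=
  Subtype.ext (funext h)

/-- The canonical homomorphism from `Γ` to its pro-`p` completion. -/
def of : Γ →* ProPCompletion p Γ where
  toFun x := ⟨fun _ => QuotientGroup.mk x, fun _ _ _ => rfl⟩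
  map_one' := rfl
  map_mul' _ _ := rfl

variable [Fact p.Prime]

/-- The map of pro-`p` completions induced by a group homomorphism. -/
def mapFun (f : Γ →* Δ) (x : ProPCompletion p Γ) : ProPCompletion p Δ :=
  ⟨fun N => QuotientGroup.map (N.comap f).1 N.1 f le_rfl (proj (N.comap f) x), by
    intro N M h
    have hx : proj (M.comap f) x = QuotientGroup.map (N.comap f).1 (M.comap f).1
        (MonoidHom.id Γ) (Subgroup.comap_mono h) (proj (N.comap f) x) :=
      (x.2 (N.comap f) (M.comap f) (Subgroup.comap_mono h)).symm
    change QuotientGroup.map N.1 M.1 (MonoidHom.id Δ) h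
      (QuotientGroup.map (N.comap f).1 N.1 f le_rfl (proj (N.comap f) x)) =
      QuotientGroup.map (M.comap f).1 M.1 f le_rfl (proj (M.comap f) x)
    rw [hx]
    obtain ⟨y, hy⟩ := QuotientGroup.mk_surjective (proj (N.comap f) x)
    rw [← hy]
    rfl⟩

theorem proj_mapFun (f : Γ →* Δ) (N : PIndexSubgroup p Δ) (x : ProPCompletion p Γ) :
    proj N (mapFun f x) = QuotientGroup.map (N.comap f).1 N.1 f le_rfl (proj (N.comap f) x) := rfl

/-- The continuous homomorphism of pro-`p` completions induced by a group homomorphism. -/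
def map (f : Γ →* Δ) : ProPCompletion p Γ →ₜ* ProPCompletion p Δ where
  toFun := mapFun f
  map_one' := ext fun N => by rw [proj_mapFun, map_one, map_one, map_one]
  map_mul' x y := ext fun N => by
    rw [map_mul, proj_mapFun, proj_mapFun, proj_mapFun, map_mul, map_mul]
  continuous_toFun := continuous_iInf_rng.2 fun N => continuous_induced_rng.2 <|
    letI : TopologicalSpace (Γ ⧸ (N.comap f).1) := ⊥
    letI : TopologicalSpace (Δ ⧸ N.1) := ⊥
    (continuous_bot (f := QuotientGroup.map (N.comap f).1 N.1 f le_rfl)).comp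
      (continuous_iInf_dom (i := N.comap f) continuous_induced_dom)

theorem proj_map (f : Γ →* Δ) (N : PIndexSubgroup p Δ) (x : ProPCompletion p Γ) :
    proj N (map f x) = QuotientGroup.map (N.comap f).1 N.1 f le_rfl (proj (N.comap f) x) := rfl

theorem map_id_apply (x : ProPCompletion p Γ) : map (MonoidHom.id Γ) x = x :=
  ext fun N => by
    rw [proj_map]
    exact x.2 _ N le_rfl

theorem map_comp_apply (g : Δ →* Θ) (f : Γ →* Δ) (x : ProPCompletion p Γ) :
    map (g.comp f) x = map g (map f x) :=
  ext fun N => by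
    simp only [proj_map]
    change QuotientGroup.map ((N.comap g).comap f).1 N.1 (g.comp f) le_rfl
      (proj ((N.comap g).comap f) x) = _
    obtain ⟨y, hy⟩ := QuotientGroup.mk_surjective (proj ((N.comap g).comap f) x)
    rw [← hy]
    rfl

end ProPCompletion

/-! ## The free pro-`p`-`G` operator group -/

/-- The homomorphism of free groups with `x_{i,h} ↦ x_{i,gh}`. -/
def freeShift {G : Type} [Group G] (d : ℕ) (g : G) :
    FreeGroup (Fin d × G) →* FreeGroup (Fin d × G) :=
  FreeGroup.map fun x => (x.1, g * x.2)

/-- The free pro-`p`-`G` operator group `𝓕(d)` of rank `d`: the free pro-`p` group on the basis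
`x_{i,h}`, `i ∈ {1, …, d}`, `h ∈ G`, on which `G` acts through `g • x_{i,h} = x_{i,gh}`. -/
def FreeProPOp (p : ℕ) (G : Type) (d : ℕ) : Type :=
  ProPCompletion p (FreeGroup (Fin d × G))

namespace FreeProPOp

variable {p : ℕ} {G : Type} {d : ℕ}

instance : Group (FreeProPOp p G d) :=
  inferInstanceAs (Group (ProPCompletion p (FreeGroup (Fin d × G))))

instance : TopologicalSpace (FreeProPOp p G d) :=
  inferInstanceAs (TopologicalSpace (ProPCompletion p (FreeGroup (Fin d × G))))

instance : IsTopologicalGroup (FreeProPOp p G d) :=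
  inferInstanceAs (IsTopologicalGroup (ProPCompletion p (FreeGroup (Fin d × G))))

/-- The basis elements `x_{i,h}`. -/
def gen (i : Fin d) (h : G) : FreeProPOp p G d := ProPCompletion.of (FreeGroup.of (i, h))

variable [Fact p.Prime] [Group G]

instance : MulDistribMulAction G (FreeProPOp p G d) where
  smul g x := ProPCompletion.map (freeShift d g) x
  one_smul x := by
    change ProPCompletion.map (freeShift d 1) x = x
    have h : freeShift d (1 : G) = MonoidHom.id _ := FreeGroup.ext_hom _ _ fun a => by
      simp [freeShift]
    rw [h]
    exact ProPCompletion.map_id_apply x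
  mul_smul g g' x := by
    change ProPCompletion.map (freeShift d (g * g')) x =
      ProPCompletion.map (freeShift d g) (ProPCompletion.map (freeShift d g') x)
    have h : freeShift d (g * g') = (freeShift d g).comp (freeShift d g') :=
      FreeGroup.ext_hom _ _ fun a => by simp [freeShift, mul_assoc]
    rw [h]
    exact ProPCompletion.map_comp_apply _ _ x
  smul_mul g x y := map_mul (ProPCompletion.map (freeShift d g)) x y
  smul_one g := map_one (ProPCompletion.map (freeShift d g))

instance : ContinuousConstSMul G (FreeProPOp p G d) where
  continuous_const_smul g := (ProPCompletion.map (freeShift d g)).continuous_toFun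

theorem smul_gen (g : G) (i : Fin d) (h : G) :
    g • (gen i h : FreeProPOp p G d) = gen i (g * h) := rfl

end FreeProPOp

end ProP

/-! ## The filtrations -/

section Filtration

/-- The descending `p`-central series (closed subgroups), indexed from `1`:
`P¹ = P`, `Pⁱ⁺¹ = (Pⁱ)ᵖ [Pⁱ, P]`.  The value at `0` is irrelevant. -/
def descPCentral (p : ℕ) (P : Type) [Group P] [TopologicalSpace P] [IsTopologicalGroup P] :
    ℕ → Subgroup P
  | 0 => ⊤
  | 1 => ⊤
  | i + 2 => (Subgroup.closure ((fun x => x ^ p) '' (descPCentral p P (i + 1) : Set P)) ⊔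
      ⁅descPCentral p P (i + 1), (⊤ : Subgroup P)⁆).topologicalClosure

/-- The descending central series (closed subgroups), indexed from `1`:
`P₁ = P`, `Pᵢ₊₁ = [Pᵢ, P]`.  The value at `0` is irrelevant. -/
def descCentral (P : Type) [Group P] [TopologicalSpace P] [IsTopologicalGroup P] :
    ℕ → Subgroup P
  | 0 => ⊤
  | 1 => ⊤
  | i + 2 => (⁅descCentral P (i + 1), (⊤ : Subgroup P)⁆).topologicalClosure

/-- The refined filtration `P^(ν) = P^(i,j) = (Pⁱ ∩ Pⱼ) Pⁱ⁺¹` for `ν = (i, j)`. -/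
def nuFil (p : ℕ) (P : Type) [Group P] [TopologicalSpace P] [IsTopologicalGroup P]
    (ν : ℕ × ℕ) : Subgroup P :=
  (descPCentral p P ν.1 ⊓ descCentral P ν.2) ⊔ descPCentral p P (ν.1 + 1)

/-- The successor `ν + 1` of `ν = (i, j)`, `i ≥ j ≥ 1`, in the lexicographic order:
`(i, j + 1)` if `i > j` and `(i + 1, 1)` if `i = j`. -/
def nuSucc (ν : ℕ × ℕ) : ℕ × ℕ := if ν.2 < ν.1 then (ν.1, ν.2 + 1) else (ν.1 + 1, 1)

variable {p : ℕ} {P Q R : Type} [Group P] [TopologicalSpace P] [IsTopologicalGroup P]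
  [Group Q] [TopologicalSpace Q] [IsTopologicalGroup Q]
  [Group R] [TopologicalSpace R] [IsTopologicalGroup R]

theorem topologicalClosure_le_comap (ψ : P →ₜ* Q) {A : Subgroup P} {B : Subgroup Q}
    (h : A ≤ B.topologicalClosure.comap (ψ : P →* Q)) :
    A.topologicalClosure ≤ B.topologicalClosure.comap (ψ : P →* Q) :=
  A.topologicalClosure_minimal h (B.isClosed_topologicalClosure.preimage ψ.continuous_toFun)

theorem descPCentral_le_comap (ψ : P →ₜ* Q) :
    ∀ i, descPCentral p P i ≤ (descPCentral p Q i).comap (ψ : P →* Q)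
  | 0 => fun _ _ => Subgroup.mem_top _
  | 1 => fun _ _ => Subgroup.mem_top _
  | i + 2 => by
    have ih := descPCentral_le_comap ψ (i + 1)
    rw [descPCentral, descPCentral]
    refine topologicalClosure_le_comap ψ (le_trans ?_
      (Subgroup.comap_mono (Subgroup.le_topologicalClosure _)))
    refine sup_le ?_ (Subgroup.commutator_le.2 ?_)
    · rw [Subgroup.closure_le]
      rintro _ ⟨x, hx, rfl⟩
      refine Subgroup.mem_comap.2 (Subgroup.mem_sup_left (Subgroup.subset_closure ?_))
      exact ⟨ψ x, ih hx, (map_pow ψ x p).symm⟩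
    · intro x hx y _
      rw [Subgroup.mem_comap, map_commutatorElement]
      exact Subgroup.mem_sup_right
        (Subgroup.commutator_mem_commutator (ih hx) (Subgroup.mem_top _))

theorem descCentral_le_comap (ψ : P →ₜ* Q) :
    ∀ i, descCentral P i ≤ (descCentral Q i).comap (ψ : P →* Q)
  | 0 => fun _ _ => Subgroup.mem_top _
  | 1 => fun _ _ => Subgroup.mem_top _
  | i + 2 => by
    have ih := descCentral_le_comap ψ (i + 1)
    rw [descCentral, descCentral]
    refine topologicalClosure_le_comap ψ (le_trans ?_
      (Subgroup.comap_mono (Subgroup.le_topologicalClosure _)))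
    refine Subgroup.commutator_le.2 ?_
    intro x hx y _
    rw [Subgroup.mem_comap, map_commutatorElement]
    exact Subgroup.commutator_mem_commutator (ih hx) (Subgroup.mem_top _)

theorem nuFil_le_comap (ν : ℕ × ℕ) (ψ : P →ₜ* Q) :
    nuFil p P ν ≤ (nuFil p Q ν).comap (ψ : P →* Q) := by
  refine sup_le (fun x hx => ?_) (fun x hx => ?_)
  · exact Subgroup.mem_sup_left
      ⟨descPCentral_le_comap ψ _ hx.1, descCentral_le_comap ψ _ hx.2⟩
  · exact Subgroup.mem_sup_right (descPCentral_le_comap ψ _ hx)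

/-- Conjugation `y ↦ x y x⁻¹` as a continuous endomorphism. -/
def conjHom (x : P) : P →ₜ* P where
  toMonoidHom := (MulAut.conj x).toMonoidHom
  continuous_toFun := by
    change Continuous fun y => x * y * x⁻¹
    fun_prop

instance nuFil_normal (ν : ℕ × ℕ) : (nuFil p P ν).Normal :=
  ⟨fun _ hx g => nuFil_le_comap ν (conjHom g) hx⟩

theorem descPCentral_succ_le : ∀ i, descPCentral p P (i + 1) ≤ descPCentral p P i
  | 0 => le_top
  | 1 => le_top
  | i + 2 => by
    have ih := descPCentral_succ_le (i + 1)
    exact Subgroup.topologicalClosure_mono (sup_le_sup (Subgroup.closure_mono (Set.image_mono ih))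
      (Subgroup.commutator_mono ih le_rfl))

theorem nuFil_le_descPCentral (ν : ℕ × ℕ) : nuFil p P ν ≤ descPCentral p P ν.1 :=
  sup_le inf_le_left (descPCentral_succ_le _)

theorem descPCentral_le_nuFil_succ (ν : ℕ × ℕ) :
    descPCentral p P (ν.1 + 1) ≤ nuFil p P (nuSucc ν) := by
  unfold nuSucc
  split_ifs
  · exact le_sup_right
  · exact fun x hx => Subgroup.mem_sup_left ⟨hx, Subgroup.mem_top _⟩

theorem pow_mem_nuFil_succ {ν : ℕ × ℕ} {x : P} (hx : x ∈ nuFil p P ν) :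
    x ^ p ∈ nuFil p P (nuSucc ν) := by
  refine descPCentral_le_nuFil_succ ν ?_
  have h := nuFil_le_descPCentral ν hx
  generalize ν.1 = i at h ⊢
  rcases i with _ | i
  · exact Subgroup.mem_top _
  · exact Subgroup.le_topologicalClosure _
      (Subgroup.mem_sup_left (Subgroup.subset_closure ⟨x, h, rfl⟩))

theorem commutator_mem_nuFil_succ {ν : ℕ × ℕ} {x : P} (hx : x ∈ nuFil p P ν) (y : P) :
    x * y * x⁻¹ * y⁻¹ ∈ nuFil p P (nuSucc ν) := by
  refine descPCentral_le_nuFil_succ ν ?_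
  have h := nuFil_le_descPCentral ν hx
  generalize ν.1 = i at h ⊢
  rcases i with _ | i
  · exact Subgroup.mem_top _
  · exact Subgroup.le_topologicalClosure _
      (Subgroup.mem_sup_right (Subgroup.commutator_mem_commutator h (Subgroup.mem_top _)))

theorem conjHom_apply (x y : P) : conjHom x y = x * y * x⁻¹ := rfl

/-! ## The graded pieces `P^(ν) / P^(ν+1)` -/

/-- The quotient `P^(ν) / P^(ν+1)`, written multiplicatively. -/
abbrev GrMul (p : ℕ) (P : Type) [Group P] [TopologicalSpace P] [IsTopologicalGroup P]
    (ν : ℕ × ℕ) : Type :=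
  nuFil p P ν ⧸ (nuFil p P (nuSucc ν)).subgroupOf (nuFil p P ν)

instance GrMul.instCommGroup (ν : ℕ × ℕ) : CommGroup (GrMul p P ν) where
  mul_comm a b := by
    obtain ⟨x, rfl⟩ := QuotientGroup.mk_surjective a
    obtain ⟨y, rfl⟩ := QuotientGroup.mk_surjective b
    rw [← QuotientGroup.mk_mul, ← QuotientGroup.mk_mul, QuotientGroup.eq,
      Subgroup.mem_subgroupOf]
    have h := commutator_mem_nuFil_succ (p := p) ((nuFil p P ν).inv_mem y.2) (x : P)⁻¹
    simpa [mul_assoc] using h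

/-- The graded piece `𝓔(ν) = P^(ν) / P^(ν+1)`, written additively. -/
abbrev Gr (p : ℕ) (P : Type) [Group P] [TopologicalSpace P] [IsTopologicalGroup P]
    (ν : ℕ × ℕ) : Type := Additive (GrMul p P ν)

/-- The graded pieces are vector spaces over `𝔽_p`. -/
instance Gr.instModule (ν : ℕ × ℕ) : Module (ZMod p) (Gr p P ν) :=
  AddCommGroup.zmodModule (n := p) fun a => by
    change Additive.ofMul (a.toMul ^ p) = 0
    obtain ⟨x, hx⟩ := QuotientGroup.mk_surjective a.toMul
    rw [← hx, ← QuotientGroup.mk_pow, ofMul_eq_zero, QuotientGroup.eq_one_iff,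
      Subgroup.mem_subgroupOf]
    exact pow_mem_nuFil_succ x.2

/-- The restriction `P^(ν) → Q^(ν)` of a continuous homomorphism `P → Q`. -/
def nuFilMap (ν : ℕ × ℕ) (ψ : P →ₜ* Q) : nuFil p P ν →* nuFil p Q ν :=
  ((ψ : P →* Q).comp (nuFil p P ν).subtype).codRestrict (nuFil p Q ν)
    fun x => nuFil_le_comap ν ψ x.2

/-- The linear map `P^(ν) / P^(ν+1) → Q^(ν) / Q^(ν+1)` induced by a continuous homomorphism. -/
def grMap (ν : ℕ × ℕ) (ψ : P →ₜ* Q) : Gr p P ν →ₗ[ZMod p] Gr p Q ν :=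
  AddMonoidHom.toZModLinearMap p (MonoidHom.toAdditive
    (QuotientGroup.map _ ((nuFil p Q (nuSucc ν)).subgroupOf (nuFil p Q ν)) (nuFilMap ν ψ)
      fun _ hx => nuFil_le_comap (nuSucc ν) ψ hx))

/-- The class of an element of `P^(ν)` in `P^(ν) / P^(ν+1)`. -/
def Gr.mk (ν : ℕ × ℕ) (x : nuFil p P ν) : Gr p P ν :=
  Additive.ofMul (QuotientGroup.mk x)

theorem Gr.mk_surjective (ν : ℕ × ℕ) : Function.Surjective (Gr.mk ν : nuFil p P ν → Gr p P ν) :=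
  fun a => QuotientGroup.mk_surjective a.toMul

theorem Gr.mk_eq_mk {ν : ℕ × ℕ} {x y : nuFil p P ν} :
    Gr.mk ν x = Gr.mk ν y ↔ (x : P)⁻¹ * y ∈ nuFil p P (nuSucc ν) :=
  QuotientGroup.eq

theorem grMap_mk (ν : ℕ × ℕ) (ψ : P →ₜ* Q) (x : nuFil p P ν) :
    grMap ν ψ (Gr.mk ν x) = Gr.mk ν ⟨ψ x, nuFil_le_comap ν ψ x.2⟩ := rfl

theorem grMap_comp_eq {S : Type} [Group S] [TopologicalSpace S] [IsTopologicalGroup S]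
    (ν : ℕ × ℕ) (ψ : Q →ₜ* R) (χ : P →ₜ* Q) (ψ' : S →ₜ* R) (χ' : P →ₜ* S)
    (h : ∀ x, ψ (χ x) = ψ' (χ' x)) :
    (grMap ν ψ : Gr p Q ν →ₗ[ZMod p] _) ∘ₗ grMap ν χ = grMap ν ψ' ∘ₗ grMap ν χ' := by
  refine LinearMap.ext fun a => ?_
  obtain ⟨x, rfl⟩ := Gr.mk_surjective ν a
  simp only [LinearMap.comp_apply, grMap_mk, h]

theorem grMap_eq_comp (ν : ℕ × ℕ) (ψ : Q →ₜ* R) (χ : P →ₜ* Q) (ω : P →ₜ* R)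
    (h : ∀ x, ω x = ψ (χ x)) :
    (grMap ν ω : Gr p P ν →ₗ[ZMod p] _) = grMap ν ψ ∘ₗ grMap ν χ := by
  refine LinearMap.ext fun a => ?_
  obtain ⟨x, rfl⟩ := Gr.mk_surjective ν a
  simp only [LinearMap.comp_apply, grMap_mk, h]

theorem grMap_eq_id (ν : ℕ × ℕ) (ψ : P →ₜ* P) (h : ∀ x, ψ x = x) :
    (grMap ν ψ : Gr p P ν →ₗ[ZMod p] _) = LinearMap.id := by
  refine LinearMap.ext fun a => ?_
  obtain ⟨x, rfl⟩ := Gr.mk_surjective ν a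
  simp only [grMap_mk, h, LinearMap.id_apply]

/-- The conjugation action of `P / P^(ν)` on `P^(ν) / P^(ν+1)`. -/
def conjRep (p : ℕ) (P : Type) [Group P] [TopologicalSpace P] [IsTopologicalGroup P]
    (ν : ℕ × ℕ) : Representation (ZMod p) (P ⧸ nuFil p P ν) (Gr p P ν) :=
  QuotientGroup.lift (nuFil p P ν)
    { toFun := fun x => grMap ν (conjHom x)
      map_one' := grMap_eq_id ν _ fun x => by simp [conjHom_apply]
      map_mul' := fun x y => grMap_eq_comp ν _ _ _ fun z => by simp [conjHom_apply, mul_assoc] }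
    fun x hx => by
      change grMap ν (conjHom x) = LinearMap.id
      refine LinearMap.ext fun a => ?_
      obtain ⟨y, rfl⟩ := Gr.mk_surjective ν a
      rw [grMap_mk, LinearMap.id_apply, Gr.mk_eq_mk]
      change (x * (y : P) * x⁻¹)⁻¹ * y ∈ _
      have h := commutator_mem_nuFil_succ (p := p) hx (y : P)⁻¹
      simpa [mul_assoc] using h

theorem conjRep_mk (ν : ℕ × ℕ) (x : P) :
    conjRep p P ν (QuotientGroup.mk x) = grMap ν (conjHom x) := rfl

/-! ## The semidirect product `P / P^(ν) ⋊ G` and its action on `P^(ν) / P^(ν+1) ⊗ T` -/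

/-- The map `P / P^(ν) → Q / Q^(ν)` induced by a continuous homomorphism. -/
def quoMap (ν : ℕ × ℕ) (ψ : P →ₜ* Q) : P ⧸ nuFil p P ν →* Q ⧸ nuFil p Q ν :=
  QuotientGroup.map _ _ (ψ : P →* Q) (nuFil_le_comap ν ψ)

theorem quoMap_mk (ν : ℕ × ℕ) (ψ : P →ₜ* Q) (x : P) :
    quoMap (p := p) ν ψ (QuotientGroup.mk x) = QuotientGroup.mk (ψ x) := rfl

variable {G : Type} [Group G] [MulDistribMulAction G P] [ContinuousConstSMul G P]
  [MulDistribMulAction G Q] [ContinuousConstSMul G Q]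

/-- The action of `g` as a continuous endomorphism. -/
def smulHom (P : Type) [Group P] [TopologicalSpace P] [MulDistribMulAction G P]
    [ContinuousConstSMul G P] (g : G) : P →ₜ* P where
  toMonoidHom := MulDistribMulAction.toMonoidHom P g
  continuous_toFun := continuous_const_smul g

set_option linter.unusedSectionVars false in
theorem smulHom_apply (g : G) (x : P) : smulHom P g x = g • x := rfl

/-- The action of `G` on `P / P^(ν)`. -/
def quoAct (p : ℕ) (P : Type) [Group P] [TopologicalSpace P] [IsTopologicalGroup P]
    (G : Type) [Group G] [MulDistribMulAction G P] [ContinuousConstSMul G P] (ν : ℕ × ℕ) :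
    G →* MulAut (P ⧸ nuFil p P ν) where
  toFun g :=
    { toFun := quoMap ν (smulHom P g)
      invFun := quoMap ν (smulHom P g⁻¹)
      left_inv := fun a => by
        obtain ⟨x, rfl⟩ := QuotientGroup.mk_surjective a
        simp [quoMap_mk, smulHom_apply]
      right_inv := fun a => by
        obtain ⟨x, rfl⟩ := QuotientGroup.mk_surjective a
        simp [quoMap_mk, smulHom_apply]
      map_mul' := map_mul _ }
  map_one' := by
    refine MulEquiv.ext fun a => ?_
    obtain ⟨x, rfl⟩ := QuotientGroup.mk_surjective a
    change quoMap (p := p) ν (smulHom P (1 : G)) (QuotientGroup.mk x) = QuotientGroup.mk x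
    simp [quoMap_mk, smulHom_apply]
  map_mul' g h := by
    refine MulEquiv.ext fun a => ?_
    obtain ⟨x, rfl⟩ := QuotientGroup.mk_surjective a
    change quoMap (p := p) ν (smulHom P (g * h)) (QuotientGroup.mk x) =
      quoMap (p := p) ν (smulHom P g) (quoMap (p := p) ν (smulHom P h) (QuotientGroup.mk x))
    simp [quoMap_mk, smulHom_apply, mul_smul]

theorem quoAct_mk (ν : ℕ × ℕ) (g : G) (x : P) :
    quoAct p P G ν g (QuotientGroup.mk x) = QuotientGroup.mk (g • x) := rfl

/-- The group `P / P^(ν) ⋊ G`. -/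
abbrev SemiQuo (p : ℕ) (P : Type) [Group P] [TopologicalSpace P] [IsTopologicalGroup P]
    (G : Type) [Group G] [MulDistribMulAction G P] [ContinuousConstSMul G P] (ν : ℕ × ℕ) : Type :=
  (P ⧸ nuFil p P ν) ⋊[quoAct p P G ν] G

/-- The action of `P / P^(ν) ⋊ G` on `P^(ν) / P^(ν+1)`: `P / P^(ν)` acts by conjugation, and `G`
acts through its action on `P`. -/
def grRep (p : ℕ) (P : Type) [Group P] [TopologicalSpace P] [IsTopologicalGroup P]
    (G : Type) [Group G] [MulDistribMulAction G P] [ContinuousConstSMul G P] (ν : ℕ × ℕ) :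
    Representation (ZMod p) (SemiQuo p P G ν) (Gr p P ν) where
  toFun s := conjRep p P ν s.left ∘ₗ grMap ν (smulHom P s.right)
  map_one' := by
    rw [SemidirectProduct.one_left, SemidirectProduct.one_right, map_one,
      grMap_eq_id ν (smulHom P (1 : G)) fun x => by simp [smulHom_apply]]
    rfl
  map_mul' s s' := by
    obtain ⟨a, g⟩ := s
    obtain ⟨b, h⟩ := s'
    obtain ⟨x, rfl⟩ := QuotientGroup.mk_surjective a
    obtain ⟨y, rfl⟩ := QuotientGroup.mk_surjective b
    simp only [SemidirectProduct.mul_def, quoAct_mk, ← QuotientGroup.mk_mul, conjRep_mk]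
    refine LinearMap.ext fun c => ?_
    obtain ⟨z, rfl⟩ := Gr.mk_surjective ν c
    simp only [Module.End.mul_apply, LinearMap.comp_apply, grMap_mk, smulHom_apply]
    congr 2
    simp [conjHom_apply, mul_smul, smul_mul', mul_assoc]

variable {T : Type} [AddCommGroup T] [Module (ZMod p) T] (τ : Representation (ZMod p) G T)

/-- The coefficient module `P^(ν) / P^(ν+1) ⊗ T` with the diagonal action of `P / P^(ν) ⋊ G`,
which acts on `T` through its projection to `G`. -/
noncomputable def coeffRep (P : Type) [Group P] [TopologicalSpace P] [IsTopologicalGroup P]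
    [MulDistribMulAction G P] [ContinuousConstSMul G P] (ν : ℕ × ℕ) :
    Rep.{0} (ZMod p) (SemiQuo p P G ν) :=
  Rep.of ((grRep p P G ν).tprod (τ.comp SemidirectProduct.rightHom))

/-- The same module as a module over `P / P^(ν)`. -/
noncomputable def coeffRepQuo (P : Type) [Group P] [TopologicalSpace P] [IsTopologicalGroup P]
    [MulDistribMulAction G P] [ContinuousConstSMul G P] (ν : ℕ × ℕ) :
    Rep.{0} (ZMod p) (P ⧸ nuFil p P ν) :=
  Rep.res SemidirectProduct.inl (coeffRep τ P ν)

/-- The homomorphism `P / P^(ν) ⋊ G → Q / Q^(ν) ⋊ G` induced by a `G`-operator homomorphism. -/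
def semiMap (ν : ℕ × ℕ) (ψ : P →ₜ* Q) (hψ : ∀ (g : G) (x : P), ψ (g • x) = g • ψ x) :
    SemiQuo p P G ν →* SemiQuo p Q G ν :=
  SemidirectProduct.map (quoMap ν ψ) (MonoidHom.id G) fun g => by
    ext x
    simp [quoMap_mk, quoAct_mk, hψ]

theorem grMap_grRep (ν : ℕ × ℕ) (ψ : P →ₜ* Q) (hψ : ∀ (g : G) (x : P), ψ (g • x) = g • ψ x)
    (s : SemiQuo p P G ν) :
    grMap ν ψ ∘ₗ grRep p P G ν s = grRep p Q G ν (semiMap ν ψ hψ s) ∘ₗ grMap ν ψ := by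
  obtain ⟨a, g⟩ := s
  obtain ⟨x, rfl⟩ := QuotientGroup.mk_surjective a
  refine LinearMap.ext fun c => ?_
  obtain ⟨z, rfl⟩ := Gr.mk_surjective ν c
  change grMap ν ψ (grMap ν (conjHom x) (grMap ν (smulHom P g) (Gr.mk ν z))) =
    grMap ν (conjHom (ψ x)) (grMap ν (smulHom Q g) (grMap ν ψ (Gr.mk ν z)))
  simp only [grMap_mk, smulHom_apply]
  congr 2
  simp [conjHom_apply, hψ]

/-- The map `ψ_* ⊗ id` on coefficients, compatible with the action of `P / P^(ν) ⋊ G`. -/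
noncomputable def coeffMap (ν : ℕ × ℕ) (ψ : P →ₜ* Q)
    (hψ : ∀ (g : G) (x : P), ψ (g • x) = g • ψ x) :
    coeffRep τ P ν ⟶ Rep.res (semiMap ν ψ hψ) (coeffRep τ Q ν) :=
  Rep.ofHom ⟨TensorProduct.map (grMap ν ψ) LinearMap.id, fun s => by
    change TensorProduct.map _ _ ∘ₗ TensorProduct.map (grRep p P G ν s) (τ s.right) =
      TensorProduct.map (grRep p Q G ν (semiMap ν ψ hψ s)) (τ s.right) ∘ₗ TensorProduct.map _ _
    rw [← TensorProduct.map_comp, ← TensorProduct.map_comp, grMap_grRep, LinearMap.id_comp,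
      LinearMap.comp_id]⟩

/-- The map `ψ_* ⊗ id` on coefficients, compatible with the action of `P / P^(ν)`. -/
noncomputable def coeffMapQuo (ν : ℕ × ℕ) (ψ : P →ₜ* Q)
    (hψ : ∀ (g : G) (x : P), ψ (g • x) = g • ψ x) :
    coeffRepQuo τ P ν ⟶ Rep.res (quoMap ν ψ) (coeffRepQuo τ Q ν) :=
  Rep.ofHom ⟨TensorProduct.map (grMap ν ψ) LinearMap.id, fun a => by
    have h := (coeffMap τ ν ψ hψ).hom.2 (SemidirectProduct.inl a)
    have e : semiMap ν ψ hψ (SemidirectProduct.inl a) = SemidirectProduct.inl (quoMap ν ψ a) :=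
      SemidirectProduct.map_inl ..
    change _ = (coeffRep τ Q ν).ρ (SemidirectProduct.inl (quoMap ν ψ a)) ∘ₗ _
    rw [← e]
    exact h⟩

/-- `ψ_* : H₁(P/P^(ν) ⋊ G, P^(ν)/P^(ν+1) ⊗ T) → H₁(Q/Q^(ν) ⋊ G, Q^(ν)/Q^(ν+1) ⊗ T)`, the map on
group homology induced by a continuous `G`-operator homomorphism `ψ : P → Q`. -/
noncomputable def h1Map (ν : ℕ × ℕ) (ψ : P →ₜ* Q)
    (hψ : ∀ (g : G) (x : P), ψ (g • x) = g • ψ x) :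
    groupHomology (coeffRep τ P ν) 1 ⟶ groupHomology (coeffRep τ Q ν) 1 :=
  groupHomology.map (semiMap ν ψ hψ) (coeffMap τ ν ψ hψ) 1

/-- `ψ_* : H₁(P/P^(ν), P^(ν)/P^(ν+1) ⊗ T) → H₁(Q/Q^(ν), Q^(ν)/Q^(ν+1) ⊗ T)`, the map on
group homology induced by a continuous `G`-operator homomorphism `ψ : P → Q`. -/
noncomputable def h1MapQuo (ν : ℕ × ℕ) (ψ : P →ₜ* Q)
    (hψ : ∀ (g : G) (x : P), ψ (g • x) = g • ψ x) :
    groupHomology (coeffRepQuo τ P ν) 1 ⟶ groupHomology (coeffRepQuo τ Q ν) 1 :=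
  groupHomology.map (quoMap ν ψ) (coeffMapQuo τ ν ψ hψ) 1

end Filtration

/-! The map `ψ` is found inside an explicit family. Take `n * N` of the indices `a`, arranged in `n`
blocks of size `N`. For a tuple `c` of `n` vectors in `𝔽_p^N` let `ψ_c` send `x_{a,g}` to `x_{b,g} ^
c(b,k)` if `a` is the `k`-th index of block `b`, and to `1` if `a` lies in no block. Each `ψ_c` is
equivariant and `ψ_0` is trivial. If every vector `c b` is nonzero, then `ψ_c` is onto, since an
exponent prime to `p` is invertible in every `p`-group (`opHom_surjective`). It remains to choose
`c` with nonzero blocks such that the given classes die.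

Represent the classes by cycles `z` and follow `c ↦ ψ_c(z)` into one-chains modulo one-boundaries
for `𝓕(n)`, a finite-dimensional space that does not depend on `m`. For `ν = (i + 1, j)` this
function is polynomial in each single block, of degree at most `2 ^ i + 1`, and it vanishes at `c =
0`. Once `N` exceeds the degree bound times the number of scalar equations, Chevalley–Warning yields
a second zero besides the origin of a block; handling the blocks in turn makes them all nonzero
(`exists_common_zero`).

The degree has two sources. On coefficients, `ψ_c` is linear in a block on `P / P²`, and `p`-th
powers and commutators carry polynomiality up the descending `p`-central series, at most doubling
the degree at each stage (`descPCentral_le_polySubgroup`). On the group variable, `P / P^(ν)` acts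
trivially on the coefficients, so modulo boundaries a chain `q ⊗ a` is biadditive in `q` and `a` and
depends only on the class of `q` in `Q / Q²`. This adds one to the degree
(`mkQ_single_mem_polyFun`). -/

/-! ## Polynomial functions on `𝔽_pˢ` with values in vector spaces -/

section PolyFun

variable {K : Type*} [Field K] {σ W W' W'' : Type*} [AddCommGroup W] [Module K W]
  [AddCommGroup W'] [Module K W'] [AddCommGroup W''] [Module K W'']

/-- The vector-valued polynomial functions of degree at most `d`. -/
def polyFun (K σ W : Type*) [Field K] [AddCommGroup W] [Module K W] (d : ℕ) :
    Submodule K ((σ → K) → W) :=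
  Submodule.span K {f | ∃ (P : MvPolynomial σ K) (w : W), P.totalDegree ≤ d ∧
    f = fun y => MvPolynomial.eval y P • w}

theorem polyFun_mono {d e : ℕ} (h : d ≤ e) : polyFun K σ W d ≤ polyFun K σ W e :=
  Submodule.span_mono fun _ ⟨P, w, hP, hf⟩ => ⟨P, w, hP.trans h, hf⟩

theorem const_mem_polyFun (w : W) (d : ℕ) : (fun _ => w) ∈ polyFun K σ W d :=
  Submodule.subset_span ⟨1, w, by simp, by simp⟩

theorem coord_smul_mem_polyFun (s : σ) (w : W) : (fun y => y s • w) ∈ polyFun K σ W 1 :=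
  Submodule.subset_span ⟨MvPolynomial.X s, w, by simp, by simp⟩

theorem comp_mem_polyFun (L : W →ₗ[K] W') {d : ℕ} {f : (σ → K) → W}
    (hf : f ∈ polyFun K σ W d) : (fun y => L (f y)) ∈ polyFun K σ W' d := by
  induction hf using Submodule.span_induction with
  | mem f hf =>
    obtain ⟨P, w, hP, rfl⟩ := hf
    exact Submodule.subset_span ⟨P, L w, hP, by simp⟩
  | zero => simpa using const_mem_polyFun (0 : W') d
  | add f g _ _ hf hg =>
    convert add_mem hf hg using 1
    ext y
    simp
  | smul c f _ hf =>
    convert Submodule.smul_mem _ c hf using 1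
    ext y
    simp

theorem eval_smul_mem_polyFun {P : MvPolynomial σ K} {d e : ℕ} (hP : P.totalDegree ≤ d)
    {f : (σ → K) → W} (hf : f ∈ polyFun K σ W e) :
    (fun y => MvPolynomial.eval y P • f y) ∈ polyFun K σ W (d + e) := by
  induction hf using Submodule.span_induction with
  | mem f hf =>
    obtain ⟨Q, w, hQ, rfl⟩ := hf
    refine Submodule.subset_span ⟨P * Q, w,
      (MvPolynomial.totalDegree_mul _ _).trans (add_le_add hP hQ), ?_⟩
    simp [mul_smul]
  | zero => simpa using const_mem_polyFun (0 : W) (d + e)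
  | add f g _ _ hf hg =>
    convert add_mem hf hg using 1
    ext y
    simp
  | smul c f _ hf =>
    convert Submodule.smul_mem _ c hf using 1
    ext y
    exact smul_comm _ _ _

theorem comp₂_mem_polyFun (B : W →ₗ[K] W' →ₗ[K] W'') {d e : ℕ} {f : (σ → K) → W}
    {g : (σ → K) → W'} (hf : f ∈ polyFun K σ W d) (hg : g ∈ polyFun K σ W' e) :
    (fun y => B (f y) (g y)) ∈ polyFun K σ W'' (d + e) := by
  induction hf using Submodule.span_induction with
  | mem f hf =>
    obtain ⟨P, w, hP, rfl⟩ := hf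
    simpa using eval_smul_mem_polyFun hP (comp_mem_polyFun (B w) hg)
  | zero => simpa using const_mem_polyFun (0 : W'') (d + e)
  | add f g _ _ hf hg =>
    convert add_mem hf hg using 1
    ext y
    simp
  | smul c f _ hf =>
    convert Submodule.smul_mem _ c hf using 1
    ext y
    simp

theorem exists_eval_eq_of_mem_polyFun {d : ℕ} {f : (σ → K) → K} (hf : f ∈ polyFun K σ K d) :
    ∃ P : MvPolynomial σ K, P.totalDegree ≤ d ∧ ∀ y, MvPolynomial.eval y P = f y := by
  induction hf using Submodule.span_induction with
  | mem f hf =>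
    obtain ⟨P, w, hP, rfl⟩ := hf
    refine ⟨w • P, (MvPolynomial.totalDegree_smul_le _ _).trans hP, fun y => ?_⟩
    simp [mul_comm]
  | zero => exact ⟨0, by simp, by simp⟩
  | add f g _ _ hf hg =>
    obtain ⟨P, hP, hf⟩ := hf
    obtain ⟨Q, hQ, hg⟩ := hg
    exact ⟨P + Q, (MvPolynomial.totalDegree_add _ _).trans (max_le hP hQ), by simp [hf, hg]⟩
  | smul c f _ hf =>
    obtain ⟨P, hP, hf⟩ := hf
    exact ⟨c • P, (MvPolynomial.totalDegree_smul_le _ _).trans hP, by simp [hf]⟩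

end PolyFun

/-! ### Nontrivial common zeros by Chevalley–Warning -/

section CommonZero

variable {p : ℕ} [Fact p.Prime] {W : Type*} [AddCommGroup W] [Module (ZMod p) W]
  [Module.Finite (ZMod p) W]

/-- **Chevalley–Warning** for vector-valued polynomial functions. -/
theorem exists_ne_zero_common_zero {ι σ : Type*} [Fintype ι] [Fintype σ] {d : ℕ}
    (hd : Fintype.card ι * Module.finrank (ZMod p) W * d < Fintype.card σ)
    (f : ι → (σ → ZMod p) → W) (hf : ∀ α, f α ∈ polyFun (ZMod p) σ W d) (h0 : ∀ α, f α 0 = 0) :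
    ∃ y, y ≠ 0 ∧ ∀ α, f α y = 0 := by
  classical
  let b := Module.finBasis (ZMod p) W
  have h := fun (x : ι × Fin (Module.finrank (ZMod p) W)) =>
    exists_eval_eq_of_mem_polyFun (comp_mem_polyFun (b.coord x.2) (hf x.1))
  choose P hP hPf using h
  have key : ∀ y, (∀ x, MvPolynomial.eval y (P x) = 0) ↔ ∀ α, f α y = 0 := fun y => by
    simp only [hPf, Prod.forall]
    exact forall_congr' fun α => b.forall_coord_eq_zero_iff
  -- In coordinates there are `card ι * finrank W` scalar polynomials of degree at most `d`, so `hd`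
  -- is the degree condition of Warning's theorem, and `p` divides the number of common zeros. If
  -- the origin were the only one, `p` would divide `1`.
  have hdvd := char_dvd_card_solutions_of_fintype_sum_lt p (f := P) (by
    refine (Finset.sum_le_sum fun x _ => hP x).trans_lt ?_
    simpa using hd)
  by_contra! hne
  have hu : ∀ y : {y // ∀ x, MvPolynomial.eval y (P x) = 0}, y = ⟨0, (key 0).2 h0⟩ := by
    rintro ⟨y, hy⟩
    by_contra hy'
    obtain ⟨α, hα⟩ := hne y fun h => hy' (Subtype.ext h)
    exact hα ((key y).1 hy α)
  have : Fintype.card {y // ∀ x, MvPolynomial.eval y (P x) = 0} = 1 :=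
    Fintype.card_eq_one_iff.2 ⟨_, hu⟩
  rw [this] at hdvd
  exact (Fact.out : p.Prime).one_lt.ne' (Nat.dvd_one.1 hdvd)

/-- Functions that are polynomial in each of `n` large blocks of variables and vanish at the origin
have a common zero with all blocks nonzero. -/
theorem exists_common_zero {ι : Type*} [Fintype ι] {n N d : ℕ}
    (hd : Fintype.card ι * Module.finrank (ZMod p) W * d < N)
    (f : ι → (Fin n → Fin N → ZMod p) → W)
    (hf : ∀ α c b, (fun y => f α (Function.update c b y)) ∈ polyFun (ZMod p) (Fin N) W d)
    (h0 : ∀ α, f α 0 = 0) :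
    ∃ c, (∀ b, c b ≠ 0) ∧ ∀ α, f α c = 0 := by
  -- Blocks are made nonzero one at a time. Keeping the untreated blocks equal to zero ensures that
  -- the origin of the next block is again a common zero.
  suffices h : ∀ S : Finset (Fin n), ∃ c : Fin n → Fin N → ZMod p,
      (∀ b ∈ S, c b ≠ 0) ∧ (∀ b ∉ S, c b = 0) ∧ ∀ α, f α c = 0 by
    obtain ⟨c, hc, -, hc'⟩ := h Finset.univ
    exact ⟨c, fun b => hc b (Finset.mem_univ b), hc'⟩
  intro S
  induction S using Finset.induction_on with
  | empty => exact ⟨0, by simp, by simp, h0⟩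
  | insert b S hb ih =>
    obtain ⟨c, hc, hc0, hfc⟩ := ih
    obtain ⟨y, hy, hfy⟩ := exists_ne_zero_common_zero (by simpa using hd) _
      (fun α => hf α c b) fun α => by
        rw [← hfc α, ← hc0 b hb, Function.update_eq_self]
    refine ⟨Function.update c b y, fun b' hb' => ?_, fun b' hb' => ?_, hfy⟩
    · rcases eq_or_ne b' b with rfl | hne
      · simpa using hy
      · simpa [hne] using hc b' ((Finset.mem_insert.1 hb').resolve_left hne)
    · rw [Finset.mem_insert, not_or] at hb'
      simpa [hb'.1] using hc0 b' hb'.2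

end CommonZero

/-! ## Topology of the pro-`p` completion -/

section Completion

theorem PIndexSubgroup.finite_quotient {p : ℕ} [hp : Fact p.Prime] {Γ : Type} [Group Γ]
    (N : PIndexSubgroup p Γ) : Finite (Γ ⧸ N.1) := by
  obtain ⟨k, hk⟩ := N.2.2
  have : N.1.index ≠ 0 := hk ▸ pow_ne_zero _ hp.out.ne_zero
  have : N.1.FiniteIndex := ⟨this⟩
  infer_instance

/-- The intersection of two normal subgroups of `p`-power index. -/
def PIndexSubgroup.inf {p : ℕ} [Fact p.Prime] {Γ : Type} [Group Γ]
    (N M : PIndexSubgroup p Γ) : PIndexSubgroup p Γ :=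
  ⟨N.1 ⊓ M.1, inferInstance, by
    obtain ⟨k, hk⟩ := N.2.2
    obtain ⟨l, hl⟩ := M.2.2
    have h : (N.1 ⊓ M.1).index ∣ p ^ (k + l) := by
      rw [← Subgroup.relIndex_mul_index (inf_le_right : N.1 ⊓ M.1 ≤ M.1),
        Subgroup.inf_relIndex_right, pow_add, ← hk, ← hl]
      exact mul_dvd_mul_right (Subgroup.relIndex_dvd_index_of_normal _ _) _
    obtain ⟨r, -, hr⟩ := (Nat.dvd_prime_pow Fact.out).1 h
    exact ⟨r, hr⟩⟩

namespace ProPCompletion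

variable {p : ℕ} {Γ Δ : Type} [Group Γ] [Group Δ]

theorem isOpen_proj_preimage (N : PIndexSubgroup p Γ) (s : Set (Γ ⧸ N.1)) :
    IsOpen ((proj N : ProPCompletion p Γ →* Γ ⧸ N.1) ⁻¹' s) := by
  let : TopologicalSpace (Γ ⧸ N.1) := ⊥
  have : DiscreteTopology (Γ ⧸ N.1) := ⟨rfl⟩
  exact (isOpen_discrete s).preimage (continuous_iInf_dom (i := N) continuous_induced_dom)

theorem isClosed_proj_preimage (N : PIndexSubgroup p Γ) (s : Set (Γ ⧸ N.1)) :
    IsClosed ((proj N : ProPCompletion p Γ →* Γ ⧸ N.1) ⁻¹' s) :=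
  ⟨isOpen_proj_preimage N sᶜ⟩

theorem proj_of (N : PIndexSubgroup p Γ) (x : Γ) :
    proj N (of x : ProPCompletion p Γ) = QuotientGroup.mk x := rfl

theorem proj_eq_of_le {N M : PIndexSubgroup p Γ} (h : N.1 ≤ M.1) {x y : ProPCompletion p Γ}
    (hxy : proj N x = proj N y) : proj M x = proj M y := by
  have hx : QuotientGroup.map N.1 M.1 (MonoidHom.id Γ) h (proj N x) = proj M x := x.2 N M h
  have hy : QuotientGroup.map N.1 M.1 (MonoidHom.id Γ) h (proj N y) = proj M y := y.2 N M h
  rw [← hx, ← hy, hxy]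

theorem map_of [Fact p.Prime] (f : Γ →* Δ) (x : Γ) :
    map f (of x : ProPCompletion p Γ) = of (f x) := rfl

instance [Fact p.Prime] : CompactSpace (ProPCompletion p Γ) := by
  let : ∀ N : PIndexSubgroup p Γ, TopologicalSpace (Γ ⧸ N.1) := fun _ => ⊥
  have : ∀ N : PIndexSubgroup p Γ, DiscreteTopology (Γ ⧸ N.1) := fun _ => ⟨rfl⟩
  have : ∀ N : PIndexSubgroup p Γ, Finite (Γ ⧸ N.1) := fun N => N.finite_quotient
  let F : ProPCompletion p Γ → (N : PIndexSubgroup p Γ) → Γ ⧸ N.1 := fun x N => proj N x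
  have hF : Topology.IsInducing F := ⟨by
    rw [Pi.topologicalSpace, induced_iInf]
    simp_rw [induced_compose]
    rfl⟩
  have hr : Set.range F = ⋂ (N : PIndexSubgroup p Γ) (M : PIndexSubgroup p Γ) (h : N.1 ≤ M.1),
      {x | QuotientGroup.map N.1 M.1 (MonoidHom.id Γ) h (x N) = x M} := by
    ext x
    simp only [Set.mem_iInter]
    exact ⟨by rintro ⟨y, rfl⟩; exact y.2, fun h => ⟨⟨x, h⟩, rfl⟩⟩
  have hcl : IsClosed (Set.range F) := by
    rw [hr]
    exact isClosed_iInter fun N => isClosed_iInter fun M => isClosed_iInter fun h =>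
    isClosed_eq (continuous_of_discreteTopology.comp (continuous_apply N))
      (continuous_apply M)
  rw [← isCompact_univ_iff, hF.isCompact_iff, Set.image_univ]
  exact hcl.isCompact

theorem exists_proj_eq_subset [Fact p.Prime] {x : ProPCompletion p Γ}
    {U : Set (ProPCompletion p Γ)} (hU : IsOpen U) (hx : x ∈ U) :
    ∃ N : PIndexSubgroup p Γ, {y | proj N y = proj N x} ⊆ U := by
  have : Nonempty (PIndexSubgroup p Γ) := ⟨⟨⊤, inferInstance, 0, by simp⟩⟩
  let τ : ∀ N : PIndexSubgroup p Γ, TopologicalSpace (Γ ⧸ N.1) := fun _ => ⊥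
  have hτ : ∀ N : PIndexSubgroup p Γ, DiscreteTopology (Γ ⧸ N.1) := fun _ => ⟨rfl⟩
  have hn : nhds x = ⨅ N : PIndexSubgroup p Γ, Filter.principal {y | proj N y = proj N x} := by
    refine (nhds_iInf (a := x)).trans (iInf_congr fun N => ?_)
    rw [nhds_induced, nhds_discrete, Filter.comap_pure]
    rfl
  have h := hU.mem_nhds hx
  rw [hn, Filter.mem_iInf_of_directed] at h
  · exact h
  · exact fun N M => ⟨N.inf M,
      Filter.principal_mono.2 fun y hy => proj_eq_of_le (N := N.inf M) inf_le_left hy,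
      Filter.principal_mono.2 fun y hy => proj_eq_of_le (N := N.inf M) inf_le_right hy⟩

/-- A point of the kernel outside the closed set `C` has a neighbourhood missing `C`, cut out by
some `M`. Approximating the point modulo `N ⊓ M` by an element of `Γ` gives an element of `N`, hence
of `C`, inside that neighbourhood. -/
theorem ker_proj_le [Fact p.Prime] {C : Subgroup (ProPCompletion p Γ)}
    (hC : IsClosed (C : Set (ProPCompletion p Γ))) (N : PIndexSubgroup p Γ)
    (hN : N.1 ≤ C.comap of) : (proj N).ker ≤ C := by
  intro x hx
  by_contra hxC
  obtain ⟨M, hM⟩ := exists_proj_eq_subset hC.isOpen_compl hxC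
  obtain ⟨γ, hγ⟩ := QuotientGroup.mk_surjective (proj (N.inf M) x)
  have hγN : proj N (of γ) = proj N x := proj_eq_of_le (N := N.inf M) inf_le_left hγ
  have hγM : proj M (of γ) = proj M x := proj_eq_of_le (N := N.inf M) inf_le_right hγ
  refine hM hγM (hN ?_)
  rwa [MonoidHom.mem_ker.1 hx, proj_of, QuotientGroup.eq_one_iff] at hγN

theorem isOpen_of_index_comap [Fact p.Prime] {C : Subgroup (ProPCompletion p Γ)} [hn : C.Normal]
    (hC : IsClosed (C : Set (ProPCompletion p Γ)))
    (h : ∃ k : ℕ, (C.comap of).index = p ^ k) : IsOpen (C : Set (ProPCompletion p Γ)) := by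
  let N : PIndexSubgroup p Γ := ⟨C.comap of, hn.comap of, h⟩
  refine Subgroup.isOpen_mono (ker_proj_le hC N le_rfl) ?_
  exact isOpen_proj_preimage N {1}

/-- The sets of solutions modulo each `N` are closed, nonempty and directed, so by compactness they
have a common point. -/
theorem map_surjective [Fact p.Prime] (f : Γ →* Δ)
    (hf : ∀ (N : PIndexSubgroup p Δ) (y : Δ), ∃ x, (f x : Δ ⧸ N.1) = y) :
    Function.Surjective (map f : ProPCompletion p Γ →ₜ* ProPCompletion p Δ) := by
  intro y
  have : Nonempty (PIndexSubgroup p Δ) := ⟨⟨⊤, inferInstance, 0, by simp⟩⟩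
  have hcl : ∀ N : PIndexSubgroup p Δ,
      IsClosed {x : ProPCompletion p Γ | proj N (map f x) = proj N y} := fun N =>
    (isClosed_proj_preimage N {proj N y}).preimage (map f).continuous_toFun
  obtain ⟨x, hx⟩ := IsCompact.nonempty_iInter_of_directed_nonempty_isCompact_isClosed
    (fun N : PIndexSubgroup p Δ => {x : ProPCompletion p Γ | proj N (map f x) = proj N y})
    (fun N M => ⟨N.inf M, fun x hx => proj_eq_of_le (N := N.inf M) inf_le_left hx,
      fun x hx => proj_eq_of_le (N := N.inf M) inf_le_right hx⟩)
    (fun N => by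
      obtain ⟨δ, hδ⟩ := QuotientGroup.mk_surjective (proj N y)
      obtain ⟨γ, hγ⟩ := hf N δ
      exact ⟨of γ, by rw [Set.mem_ofPred_eq, map_of, proj_of, hγ, hδ]⟩)
    (fun N => (hcl N).isCompact) hcl
  exact ⟨x, ext fun N => Set.mem_iInter.1 hx N⟩

end ProPCompletion

end Completion

/-! ## Openness of the descending `p`-central series -/

section Open

variable {p : ℕ} {P : Type} [Group P] [TopologicalSpace P] [IsTopologicalGroup P]

instance descPCentral_normal (i : ℕ) : (descPCentral p P i).Normal :=
  ⟨fun _ hx g => descPCentral_le_comap (conjHom g) i hx⟩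

theorem isClosed_descPCentral (i : ℕ) : IsClosed (descPCentral p P i : Set P) := by
  rcases i with _ | _ | i
  · exact isClosed_univ
  · exact isClosed_univ
  · exact Subgroup.isClosed_topologicalClosure _

theorem pow_mem_descPCentral {i : ℕ} {x : P} (hx : x ∈ descPCentral p P (i + 1)) :
    x ^ p ∈ descPCentral p P (i + 2) :=
  Subgroup.le_topologicalClosure _ (Subgroup.mem_sup_left (Subgroup.subset_closure ⟨x, hx, rfl⟩))

theorem commutator_mem_descPCentral {i : ℕ} {x : P} (hx : x ∈ descPCentral p P (i + 1)) (y : P) :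
    x * y * x⁻¹ * y⁻¹ ∈ descPCentral p P (i + 2) :=
  Subgroup.le_topologicalClosure _
    (Subgroup.mem_sup_right (Subgroup.commutator_mem_commutator hx (Subgroup.mem_top y)))

/-- Closed subgroups whose trace on `Γ` has `p`-power index are open, so it suffices to bound the
index at each step. The trace `M` is finitely generated, being of finite index in `Γ`, and its
quotient by the next trace is abelian of exponent `p`, hence a finite `p`-group. -/
theorem ProPCompletion.isOpen_descPCentral [hp : Fact p.Prime] {Γ : Type} [Group Γ] [Group.FG Γ]
    (i : ℕ) :
    IsOpen (descPCentral p (ProPCompletion p Γ) i : Set (ProPCompletion p Γ)) := by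
  refine isOpen_of_index_comap (isClosed_descPCentral i) ?_
  rcases i with _ | i
  · exact ⟨0, by simp [descPCentral]⟩
  induction i with
  | zero => exact ⟨0, by simp [descPCentral]⟩
  | succ i ih =>
    obtain ⟨k, hk⟩ := ih
    let M := (descPCentral p (ProPCompletion p Γ) (i + 1)).comap of
    let M' := (descPCentral p (ProPCompletion p Γ) (i + 2)).comap of
    have hle : M' ≤ M := Subgroup.comap_mono (descPCentral_succ_le _)
    have : M.FiniteIndex := ⟨by rw [hk]; exact pow_ne_zero _ hp.out.ne_zero⟩
    have : Group.FG M := Subgroup.fg_of_index_ne_zero M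
    have : M'.Normal := Subgroup.Normal.comap inferInstance of
    let : CommGroup (M ⧸ M'.subgroupOf M) :=
      { (inferInstance : Group (M ⧸ M'.subgroupOf M)) with
        mul_comm := fun a b => by
          obtain ⟨x, rfl⟩ := QuotientGroup.mk_surjective a
          obtain ⟨y, rfl⟩ := QuotientGroup.mk_surjective b
          rw [← QuotientGroup.mk_mul, ← QuotientGroup.mk_mul, QuotientGroup.eq,
            Subgroup.mem_subgroupOf]
          have h := commutator_mem_descPCentral (p := p) (M.inv_mem y.2) (of (x : Γ)⁻¹)
          change of _ ∈ descPCentral p (ProPCompletion p Γ) (i + 2)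
          convert h using 1
          simp [mul_assoc] }
    have hpow : ∀ a : M ⧸ M'.subgroupOf M, a ^ p = 1 := fun a => by
      obtain ⟨x, rfl⟩ := QuotientGroup.mk_surjective a
      rw [← QuotientGroup.mk_pow, QuotientGroup.eq_one_iff, Subgroup.mem_subgroupOf]
      change of ((x : Γ) ^ p) ∈ descPCentral p (ProPCompletion p Γ) (i + 2)
      rw [map_pow]
      exact pow_mem_descPCentral x.2
    have : Finite (M ⧸ M'.subgroupOf M) := CommGroup.finite_of_fg_isMulTorsion _ fun a =>
      isOfFinOrder_iff_pow_eq_one.2 ⟨p, hp.out.pos, hpow a⟩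
    obtain ⟨l, hl⟩ := IsPGroup.iff_card.1
      (fun a => ⟨1, by rw [pow_one]; exact hpow a⟩ : IsPGroup p (M ⧸ M'.subgroupOf M))
    refine ⟨l + k, ?_⟩
    change M'.index = _
    rw [← Subgroup.relIndex_mul_index hle, pow_add, ← hk, ← hl]
    rfl

end Open

/-! ## The graded pieces of the descending `p`-central series -/

section PGr

variable {p : ℕ} {P Q : Type} [Group P] [TopologicalSpace P] [IsTopologicalGroup P]
  [Group Q] [TopologicalSpace Q] [IsTopologicalGroup Q]

theorem map_mem_descPCentral (ψ : P →ₜ* Q) {i : ℕ} {x : P} (hx : x ∈ descPCentral p P i) :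
    ψ x ∈ descPCentral p Q i :=
  descPCentral_le_comap ψ i hx

theorem mem_descPCentral_one (x : P) : x ∈ descPCentral p P (0 + 1) := Subgroup.mem_top x

/-- The quotient `Pⁱ⁺¹ / Pⁱ⁺²`, written multiplicatively. -/
abbrev PGrMul (p : ℕ) (P : Type) [Group P] [TopologicalSpace P] [IsTopologicalGroup P]
    (i : ℕ) : Type :=
  descPCentral p P (i + 1) ⧸ (descPCentral p P (i + 2)).subgroupOf (descPCentral p P (i + 1))

instance PGrMul.instCommGroup (i : ℕ) : CommGroup (PGrMul p P i) where
  mul_comm a b := by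
    obtain ⟨x, rfl⟩ := QuotientGroup.mk_surjective a
    obtain ⟨y, rfl⟩ := QuotientGroup.mk_surjective b
    rw [← QuotientGroup.mk_mul, ← QuotientGroup.mk_mul, QuotientGroup.eq,
      Subgroup.mem_subgroupOf]
    have h := commutator_mem_descPCentral (p := p) ((descPCentral p P (i + 1)).inv_mem y.2)
      (x : P)⁻¹
    simpa [mul_assoc] using h

/-- The graded piece `Pⁱ⁺¹ / Pⁱ⁺²`, written additively. -/
abbrev PGr (p : ℕ) (P : Type) [Group P] [TopologicalSpace P] [IsTopologicalGroup P]
    (i : ℕ) : Type := Additive (PGrMul p P i)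

namespace PGr

/-- The class in `Pⁱ⁺¹ / Pⁱ⁺²` of an element of `P` that lies in `Pⁱ⁺¹`. -/
def cls (i : ℕ) (x : P) (hx : x ∈ descPCentral p P (i + 1)) : PGr p P i :=
  Additive.ofMul (QuotientGroup.mk ⟨x, hx⟩)

variable {i : ℕ}

theorem exists_cls_eq (a : PGr p P i) : ∃ x hx, cls i x hx = a := by
  obtain ⟨x, hx⟩ := QuotientGroup.mk_surjective a.toMul
  exact ⟨x, x.2, congrArg Additive.ofMul hx⟩

theorem cls_eq_cls {x y : P} {hx : x ∈ descPCentral p P (i + 1)}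
    {hy : y ∈ descPCentral p P (i + 1)} :
    cls i x hx = cls i y hy ↔ (x : P ⧸ descPCentral p P (i + 2)) = y :=
  QuotientGroup.eq.trans
    (QuotientGroup.eq (s := descPCentral p P (i + 2)) (a := x) (b := y)).symm

theorem cls_eq_zero {x : P} {hx : x ∈ descPCentral p P (i + 1)} :
    cls i x hx = 0 ↔ x ∈ descPCentral p P (i + 2) :=
  QuotientGroup.eq_one_iff _

theorem cls_mul {x y : P} (hx : x ∈ descPCentral p P (i + 1))
    (hy : y ∈ descPCentral p P (i + 1)) :
    cls i (x * y) (mul_mem hx hy) = cls i x hx + cls i y hy := rfl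

theorem cls_pow {x : P} (hx : x ∈ descPCentral p P (i + 1)) (n : ℕ) :
    cls i (x ^ n) (pow_mem hx n) = n • cls i x hx := rfl

theorem cls_inv {x : P} (hx : x ∈ descPCentral p P (i + 1)) :
    cls i x⁻¹ (inv_mem hx) = -cls i x hx := rfl

instance instModule : Module (ZMod p) (PGr p P i) :=
  AddCommGroup.zmodModule (n := p) fun a => by
    obtain ⟨x, hx, rfl⟩ := exists_cls_eq a
    rw [← cls_pow, cls_eq_zero]
    exact pow_mem_descPCentral hx

theorem cls_conj {x : P} (hx : x ∈ descPCentral p P (i + 1)) (g : P) :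
    cls i (g * x * g⁻¹) ((descPCentral_normal _).conj_mem x hx g) = cls i x hx := by
  rw [cls_eq_cls, QuotientGroup.eq]
  have h := commutator_mem_descPCentral (p := p) (inv_mem hx) g
  simpa [mul_assoc] using inv_mem h

/-- The additive map induced on `Pⁱ⁺¹ / Pⁱ⁺²` by a homomorphism on `Pⁱ⁺¹` that kills `Pⁱ⁺²`. -/
def lift {W : Type*} [AddCommGroup W] (θ : descPCentral p P (i + 1) →* Multiplicative W)
    (h : ∀ x : descPCentral p P (i + 1), (x : P) ∈ descPCentral p P (i + 2) → θ x = 1) :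
    PGr p P i →+ W :=
  MonoidHom.toAdditiveLeft (QuotientGroup.lift _ θ fun x hx => h x hx)

end PGr

/-- A homomorphism with closed kernel from `P` to a group of exponent `p` kills `P²`. -/
theorem descPCentral_two_le_ker {W : Type*} [AddCommGroup W] (hW : ∀ w : W, p • w = 0)
    (θ : P →* Multiplicative W) (hθ : IsClosed (θ.ker : Set P)) :
    descPCentral p P 2 ≤ θ.ker := by
  refine Subgroup.topologicalClosure_minimal _ (sup_le ?_ (Subgroup.commutator_le.2 ?_)) hθ
  · rw [Subgroup.closure_le]
    rintro _ ⟨x, -, rfl⟩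
    change θ (x ^ p) = 1
    rw [map_pow]
    exact hW (θ x).toAdd
  · intro x _ y _
    rw [MonoidHom.mem_ker, map_commutatorElement, commutatorElement_eq_one_iff_mul_comm, mul_comm]

namespace PGr

variable (i : ℕ)

/-- The homomorphism `z ↦ [x, z]` from `P` to `Pⁱ⁺² / Pⁱ⁺³` for `x ∈ Pⁱ⁺¹`. -/
def commHom (x : P) (hx : x ∈ descPCentral p P (i + 1)) :
    P →* Multiplicative (PGr p P (i + 1)) where
  toFun z := Multiplicative.ofAdd
    (cls (i + 1) (x * z * x⁻¹ * z⁻¹) (commutator_mem_descPCentral hx z))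
  map_one' := by
    refine congrArg Multiplicative.ofAdd (cls_eq_zero.2 ?_)
    simp [one_mem]
  map_mul' z w := by
    rw [← ofAdd_add]
    refine congrArg Multiplicative.ofAdd ?_
    rw [← cls_conj (commutator_mem_descPCentral hx w) z, ← cls_mul]
    congr 1
    simp [mul_assoc]

/-- The kernel is the preimage of the closed subgroup `Pⁱ⁺³` under a continuous map. This is what
makes the commutator pairing descend to `P / P²` in its second variable. -/
theorem descPCentral_two_le_ker_commHom (x : P) (hx : x ∈ descPCentral p P (i + 1)) :
    descPCentral p P 2 ≤ (commHom i x hx).ker := by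
  refine descPCentral_two_le_ker (fun w => ?_) _ ?_
  · rw [← Nat.cast_smul_eq_nsmul (ZMod p), CharP.cast_eq_zero, zero_smul]
  · have h : ((commHom i x hx).ker : Set P) =
        (fun z => x * z * x⁻¹ * z⁻¹) ⁻¹' (descPCentral p P (i + 3) : Set P) := by
      ext z
      exact cls_eq_zero
    rw [h]
    exact (isClosed_descPCentral _).preimage (by fun_prop)

variable {i} in
theorem cls_commutator_mul {x y : P} (hx : x ∈ descPCentral p P (i + 1))
    (hy : y ∈ descPCentral p P (i + 1)) (z : P) :
    cls (i + 1) (x * y * z * (x * y)⁻¹ * z⁻¹) (commutator_mem_descPCentral (mul_mem hx hy) z) =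
      cls (i + 1) (x * z * x⁻¹ * z⁻¹) (commutator_mem_descPCentral hx z) +
      cls (i + 1) (y * z * y⁻¹ * z⁻¹) (commutator_mem_descPCentral hy z) := by
  rw [← cls_conj (commutator_mem_descPCentral hy z) x,
    add_comm (cls (i + 1) (x * z * x⁻¹ * z⁻¹) _), ← cls_mul]
  congr 1
  simp [mul_assoc]

/-- The commutator pairing `Pⁱ⁺¹ / Pⁱ⁺² × P / P² → Pⁱ⁺² / Pⁱ⁺³`. -/
def comm : PGr p P i →+ PGr p P 0 →+ PGr p P (i + 1) :=
  lift
    { toFun := fun x => Multiplicative.ofAdd (lift ((commHom i x.1 x.2).comp (Subgroup.subtype _))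
        fun z hz => descPCentral_two_le_ker_commHom i x.1 x.2 hz)
      map_one' := by
        refine congrArg Multiplicative.ofAdd (AddMonoidHom.ext fun b => ?_)
        obtain ⟨z, hz, rfl⟩ := exists_cls_eq b
        refine cls_eq_zero.2 ?_
        simp [one_mem]
      map_mul' := fun x y => by
        refine congrArg Multiplicative.ofAdd (AddMonoidHom.ext fun b => ?_)
        obtain ⟨z, hz, rfl⟩ := exists_cls_eq b
        exact cls_commutator_mul x.2 y.2 z }
    fun x hx => by
      refine congrArg Multiplicative.ofAdd (AddMonoidHom.ext fun b => ?_)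
      obtain ⟨z, hz, rfl⟩ := exists_cls_eq b
      exact cls_eq_zero.2 (commutator_mem_descPCentral hx z)

theorem comm_cls {x z : P} (hx : x ∈ descPCentral p P (i + 1)) (hz : z ∈ descPCentral p P (0 + 1)) :
    comm i (cls i x hx) (cls 0 z hz) =
      cls (i + 1) (x * z * x⁻¹ * z⁻¹) (commutator_mem_descPCentral hx z) := rfl

/-- The map `Pⁱ⁺¹ / Pⁱ⁺² → P / P²` induced by the inclusion. -/
def toZero : PGr p P i →+ PGr p P 0 :=
  lift
    { toFun := fun x => Multiplicative.ofAdd (cls 0 x.1 (mem_descPCentral_one _))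
      map_one' := rfl
      map_mul' := fun _ _ => rfl }
    fun x hx => congrArg Multiplicative.ofAdd (cls_eq_zero.2 (by
      induction i with
      | zero => exact hx
      | succ i ih =>
        exact ih ⟨x, descPCentral_succ_le _ x.2⟩ (descPCentral_succ_le _ hx)))

theorem toZero_cls {x : P} (hx : x ∈ descPCentral p P (i + 1)) :
    toZero i (cls i x hx) = cls 0 x (mem_descPCentral_one _) := rfl

end PGr

/-- The power formula in a group of class two. -/
theorem mul_pow_of_commute_commutator {H : Type*} [Group H] {x y c : H} (hc : y * x = c * x * y)
    (hx : Commute c x) (hy : Commute c y) (n : ℕ) :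
    (x * y) ^ n = x ^ n * y ^ n * c ^ n.choose 2 := by
  have h : ∀ k : ℕ, y ^ k * x = c ^ k * x * y ^ k := fun k => by
    induction k with
    | zero => simp
    | succ k ih =>
      calc y ^ (k + 1) * x = y * (y ^ k * x) := by rw [pow_succ', mul_assoc]
        _ = (y * c ^ k) * x * y ^ k := by rw [ih]; simp only [mul_assoc]
        _ = c ^ k * (y * x) * y ^ k := by rw [← (hy.pow_left k).eq]; simp only [mul_assoc]
        _ = c ^ (k + 1) * x * y ^ (k + 1) := by
          rw [hc, pow_succ, pow_succ' y]; simp only [mul_assoc]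
  induction n with
  | zero => simp
  | succ n ih =>
    rw [pow_succ, ih, Nat.choose_succ_succ' n 1, Nat.choose_one_right]
    have h1 : Commute (c ^ n.choose 2) (x * y) := (hx.mul_right hy).pow_left _
    calc x ^ n * y ^ n * c ^ n.choose 2 * (x * y)
        = x ^ n * (y ^ n * x) * y * c ^ n.choose 2 := by
          rw [mul_assoc _ _ (x * y), h1.eq]; simp only [mul_assoc]
      _ = x ^ n * x * (c ^ n * (y ^ n * y)) * c ^ n.choose 2 := by
          rw [h, (hx.pow_left n).eq]; simp only [mul_assoc]
      _ = x ^ (n + 1) * y ^ (n + 1) * c ^ (n + n.choose 2) := by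
          rw [← pow_succ, ← pow_succ, ((hy.pow_left n).pow_right (n + 1)).eq, pow_add (c)]
          simp only [mul_assoc]

namespace PGr

variable {i : ℕ}

/-- The commutator of `y` and `x` lies in `Pⁱ⁺²`, hence is central modulo `Pⁱ⁺³`, and the class-two
power formula applies there. -/
theorem cls_mul_pow {x y : P} (hx : x ∈ descPCentral p P (i + 1))
    (hy : y ∈ descPCentral p P (i + 1)) :
    cls (i + 1) ((x * y) ^ p) (pow_mem_descPCentral (mul_mem hx hy)) =
      cls (i + 1) (x ^ p) (pow_mem_descPCentral hx) +
      cls (i + 1) (y ^ p) (pow_mem_descPCentral hy) +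
      p.choose 2 • comm i (cls i y hy) (toZero i (cls i x hx)) := by
  have hc := commutator_mem_descPCentral hy x
  have hcomm : ∀ g : P, Commute ((y * x * y⁻¹ * x⁻¹ : P) : P ⧸ descPCentral p P (i + 3)) g :=
    fun g => by
      have h := commutator_mem_descPCentral hc g
      rw [← QuotientGroup.eq_one_iff] at h
      exact commutatorElement_eq_one_iff_mul_comm.1 h
  rw [toZero_cls, comm_cls, ← cls_pow, ← cls_mul, ← cls_mul, cls_eq_cls]
  have h := mul_pow_of_commute_commutator
    (x := (x : P ⧸ descPCentral p P (i + 3))) (y := (y : P ⧸ descPCentral p P (i + 3)))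
    (c := ((y * x * y⁻¹ * x⁻¹ : P) : P ⧸ descPCentral p P (i + 3)))
    (by rw [← QuotientGroup.mk_mul, ← QuotientGroup.mk_mul, ← QuotientGroup.mk_mul]; simp)
    (hcomm x) (hcomm y) p
  exact h

/-- The map `Pⁱ⁺¹ / Pⁱ⁺² → Pⁱ⁺² / Pⁱ⁺³` given by `x ↦ xᵖ`. -/
noncomputable def frob (i : ℕ) (a : PGr p P i) : PGr p P (i + 1) :=
  cls (i + 1) ((exists_cls_eq a).choose ^ p)
    (pow_mem_descPCentral (exists_cls_eq a).choose_spec.choose)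

theorem frob_cls {x : P} (hx : x ∈ descPCentral p P (i + 1)) :
    frob i (cls i x hx) = cls (i + 1) (x ^ p) (pow_mem_descPCentral hx) := by
  have key : ∀ {x z : P} (hx : x ∈ descPCentral p P (i + 1)) (hz : z ∈ descPCentral p P (i + 1)),
      cls i z hz = cls i x hx → cls (i + 1) (z ^ p) (pow_mem_descPCentral hz) =
        cls (i + 1) (x ^ p) (pow_mem_descPCentral hx) := by
    intro x z hx hz h
    -- Independence of the representative: writing `z = x * u` with `u ∈ Pⁱ⁺²`, both `u ^ p` and the
    -- commutator correction vanish modulo `Pⁱ⁺³`.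
    have hu : x⁻¹ * z ∈ descPCentral p P (i + 2) := QuotientGroup.eq.1 (cls_eq_cls.1 h.symm)
    have hu' := descPCentral_succ_le _ hu
    have e := cls_mul_pow hx hu'
    rw [cls_eq_zero.2 hu, map_zero, AddMonoidHom.zero_apply, smul_zero, add_zero,
      cls_eq_zero.2 (pow_mem_descPCentral hu), add_zero] at e
    simpa using e
  exact key hx _ (exists_cls_eq (cls i x hx)).choose_spec.choose_spec

/-- The correction term is bilinear, so `frob` is at worst quadratic. For an odd prime `p` the term
vanishes because `p` divides `p.choose 2`. -/
theorem frob_add (a b : PGr p P i) :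
    frob i (a + b) = frob i a + frob i b + p.choose 2 • comm i b (toZero i a) := by
  obtain ⟨x, hx, rfl⟩ := exists_cls_eq a
  obtain ⟨y, hy, rfl⟩ := exists_cls_eq b
  rw [← cls_mul, frob_cls, frob_cls, frob_cls, cls_mul_pow]

theorem frob_zero : frob i (0 : PGr p P i) = 0 := by
  have h := frob_cls (i := i) (one_mem (descPCentral p P (i + 1)))
  rw [cls_eq_zero.2 (one_mem _)] at h
  rw [h, cls_eq_zero, one_pow]
  exact one_mem _

theorem frob_smul [NeZero p] (c : ZMod p) (a : PGr p P i) : frob i (c • a) = c • frob i a := by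
  obtain ⟨x, hx, rfl⟩ := exists_cls_eq a
  rw [← ZMod.natCast_zmod_val c, Nat.cast_smul_eq_nsmul, Nat.cast_smul_eq_nsmul, ← cls_pow,
    frob_cls, frob_cls, ← cls_pow, cls_eq_cls, ← pow_mul, ← pow_mul, mul_comm]

end PGr

end PGr

/-! ## Polynomiality of `y ↦ ψ_y` on graded pieces -/

section Poly

variable {p : ℕ} [Fact p.Prime] {P Q : Type} [Group P] [TopologicalSpace P] [IsTopologicalGroup P]
  [Group Q] [TopologicalSpace Q] [IsTopologicalGroup Q] {σ : Type*}

theorem comp_add_mem_polyFun {W W' W'' : Type*} [AddCommGroup W] [Module (ZMod p) W]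
    [AddCommGroup W'] [Module (ZMod p) W'] [AddCommGroup W''] [Module (ZMod p) W'']
    (B : W →+ W' →+ W'') {d e : ℕ} {f : (σ → ZMod p) → W}
    {g : (σ → ZMod p) → W'} (hf : f ∈ polyFun (ZMod p) σ W d)
    (hg : g ∈ polyFun (ZMod p) σ W' e) :
    (fun y => B (f y) (g y)) ∈ polyFun (ZMod p) σ W'' (d + e) :=
  comp₂_mem_polyFun (LinearMap.mk₂ (ZMod p) (fun a b => B a b) (fun a a' b => by simp)
    (fun c a b => ZMod.map_smul (B.flip b) c a) (fun a b b' => by simp)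
    (fun c a b => ZMod.map_smul (B a) c b)) hf hg

/-- On a scalar polynomial times a vector, `frob` preserves the degree by homogeneity. Only the
bilinear correction arising from sums doubles it. -/
theorem PGr.frob_mem_polyFun {i d : ℕ} {f : (σ → ZMod p) → PGr p Q i}
    (hf : f ∈ polyFun (ZMod p) σ _ d) :
    (fun y => frob i (f y)) ∈ polyFun (ZMod p) σ (PGr p Q (i + 1)) (d + d) := by
  induction hf using Submodule.span_induction with
  | mem f hf =>
    obtain ⟨R, w, hR, rfl⟩ := hf
    simp only [frob_smul]
    exact polyFun_mono (Nat.le_add_right d d) (Submodule.subset_span ⟨R, frob i w, hR, rfl⟩)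
  | zero => simpa [frob_zero] using const_mem_polyFun (0 : PGr p Q (i + 1)) (d + d)
  | add f g hf hg ihf ihg =>
    simp only [Pi.add_apply, frob_add]
    refine add_mem (add_mem ihf ihg) ?_
    have hf' := comp_mem_polyFun ((toZero i).toZModLinearMap p) hf
    have h := comp_add_mem_polyFun (comm i) hg hf'
    exact nsmul_mem h _
  | smul c f _ hf =>
    simp only [Pi.smul_apply, frob_smul]
    exact Submodule.smul_mem _ c hf

/-- The elements `x ∈ Pⁱ⁺¹` for which `y ↦ ψ_y(x)` is polynomial of degree at most `d`. -/
def polySubgroup (p : ℕ) [Fact p.Prime] (i d : ℕ) (ψ : (σ → ZMod p) → P →ₜ* Q) : Subgroup P where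
  carrier := {x | ∃ hx : x ∈ descPCentral p P (i + 1),
    (fun y => PGr.cls i (ψ y x) (map_mem_descPCentral (ψ y) hx)) ∈ polyFun (ZMod p) σ _ d}
  one_mem' := by
    refine ⟨one_mem _, ?_⟩
    convert const_mem_polyFun (0 : PGr p Q i) d using 2
    rw [PGr.cls_eq_zero, map_one]
    exact one_mem _
  mul_mem' := by
    rintro x z ⟨hx, hxp⟩ ⟨hz, hzp⟩
    refine ⟨mul_mem hx hz, ?_⟩
    convert add_mem hxp hzp using 2 with y
    rw [Pi.add_apply, ← PGr.cls_mul]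
    congr 1
    exact map_mul _ _ _
  inv_mem' := by
    rintro x ⟨hx, hxp⟩
    refine ⟨inv_mem hx, ?_⟩
    convert neg_mem hxp using 2 with y
    rw [Pi.neg_apply, ← PGr.cls_inv]
    congr 1
    exact map_inv _ _

theorem descPCentral_succ_le_polySubgroup (i d : ℕ) (ψ : (σ → ZMod p) → P →ₜ* Q) :
    descPCentral p P (i + 2) ≤ polySubgroup p i d ψ := fun x hx => by
  refine ⟨descPCentral_succ_le _ hx, ?_⟩
  convert const_mem_polyFun (0 : PGr p Q i) d using 2 with y
  exact PGr.cls_eq_zero.2 (descPCentral_le_comap (ψ y) _ hx)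

/-- Containing the open subgroup `Pⁱ⁺²` makes it open, hence closed. Polynomiality therefore passes
to the topological closures in the definition of the series. -/
theorem isClosed_polySubgroup (hP : ∀ i, IsOpen (descPCentral p P i : Set P)) (i d : ℕ)
    (ψ : (σ → ZMod p) → P →ₜ* Q) : IsClosed (polySubgroup p i d ψ : Set P) :=
  Subgroup.isClosed_of_isOpen _
    (Subgroup.isOpen_mono (descPCentral_succ_le_polySubgroup i d ψ) (hP _))

/-- If `ψ_y` depends on `y` in a polynomial way on `P / P²`, then also on `Pⁱ⁺¹ / Pⁱ⁺²`. -/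
theorem descPCentral_le_polySubgroup (hP : ∀ i, IsOpen (descPCentral p P i : Set P))
    (ψ : (σ → ZMod p) → P →ₜ* Q) (h : polySubgroup p 0 1 ψ = ⊤) (i : ℕ) :
    descPCentral p P (i + 1) ≤ polySubgroup p i (2 ^ i) ψ := by
  induction i with
  | zero => exact le_top.trans h.ge
  | succ i ih =>
    rw [pow_succ, mul_two]
    refine Subgroup.topologicalClosure_minimal _ (sup_le ?_ (Subgroup.commutator_le.2 ?_))
      (isClosed_polySubgroup hP _ _ ψ)
    · rw [Subgroup.closure_le]
      rintro _ ⟨x, hx, rfl⟩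
      obtain ⟨hx', hxp⟩ := ih hx
      refine ⟨pow_mem_descPCentral hx, ?_⟩
      convert PGr.frob_mem_polyFun hxp using 2 with y
      rw [PGr.frob_cls]
      congr 1
      exact map_pow _ _ _
    · intro x hx z _
      obtain ⟨hx', hxp⟩ := ih hx
      obtain ⟨hz, hzp⟩ : z ∈ polySubgroup p 0 1 ψ := h ▸ Subgroup.mem_top z
      refine ⟨commutator_mem_descPCentral hx z, ?_⟩
      -- A commutator with an element of `P` has degree at most `2 ^ i + 1`, which is at most `2 ^ i
      -- + 2 ^ i`.
      convert polyFun_mono (Nat.add_le_add_left Nat.one_le_two_pow _)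
        (comp_add_mem_polyFun (PGr.comm i) hxp hzp) using 2 with y
      rw [PGr.comm_cls]
      congr 1
      change ψ y (x * z * x⁻¹ * z⁻¹) = _
      simp

/-- A linear map from `Pⁱ⁺¹ / Pⁱ⁺²` that extends the projection `P^(ν) / Pⁱ⁺² → P^(ν) / P^(ν+1)`,
where `ν = (i + 1, j)`. -/
theorem exists_pGr_to_gr (i j : ℕ) :
    ∃ θ : PGr p Q i →ₗ[ZMod p] Gr p Q (i + 1, j), ∀ x : nuFil p Q (i + 1, j),
      θ (PGr.cls i x (nuFil_le_descPCentral _ x.2)) = Gr.mk _ x := by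
  let f : Additive (nuFil p Q (i + 1, j)) →+ PGr p Q i :=
    { toFun := fun x => PGr.cls i x.toMul.1 (nuFil_le_descPCentral _ x.toMul.2)
      map_zero' := rfl
      map_add' := fun _ _ => rfl }
  let g : Additive (nuFil p Q (i + 1, j)) →+ Gr p Q (i + 1, j) :=
    MonoidHom.toAdditive (QuotientGroup.mk' _)
  -- The projection is well defined on the image of `Q^(ν)` because `Qⁱ⁺² ≤ Q^(ν+1)`. That image is
  -- a subspace over a field, so the map extends linearly to all of `PGr p Q i`.
  have hfg : f.rangeRestrict.ker ≤ g.ker := by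
    intro x hx
    have hx' : f x = 0 := congrArg Subtype.val hx
    exact (QuotientGroup.eq_one_iff _).2
      (descPCentral_le_nuFil_succ (i + 1, j) (PGr.cls_eq_zero.1 hx'))
  let l := AddMonoidHom.liftOfSurjective f.rangeRestrict f.rangeRestrict_surjective ⟨g, hfg⟩
  have hl : ∀ x, l (f.rangeRestrict x) = g x := fun x =>
    AddMonoidHom.liftOfRightInverse_comp_apply _ _
      (Function.rightInverse_surjInv f.rangeRestrict_surjective) ⟨g, hfg⟩ x
  let S : Submodule (ZMod p) (PGr p Q i) := AddSubgroup.toZModSubmodule p f.range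
  let l' : S →+ Gr p Q (i + 1, j) := l
  obtain ⟨θ, hθ⟩ := LinearMap.exists_extend (l'.toZModLinearMap p)
  exact ⟨θ, fun x => (LinearMap.congr_fun hθ (f.rangeRestrict (Additive.ofMul x))).trans (hl _)⟩

theorem grMap_mem_polyFun (hP : ∀ i, IsOpen (descPCentral p P i : Set P))
    (ψ : (σ → ZMod p) → P →ₜ* Q) (h : polySubgroup p 0 1 ψ = ⊤) (i j : ℕ)
    (a : Gr p P (i + 1, j)) :
    (fun y => grMap (i + 1, j) (ψ y) a) ∈ polyFun (ZMod p) σ _ (2 ^ i) := by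
  obtain ⟨x, rfl⟩ := Gr.mk_surjective _ a
  obtain ⟨θ, hθ⟩ := exists_pGr_to_gr (p := p) (Q := Q) i j
  obtain ⟨hx, hxp⟩ := descPCentral_le_polySubgroup hP ψ h i (nuFil_le_descPCentral _ x.2)
  convert comp_mem_polyFun θ hxp using 2 with y
  rw [grMap_mk]
  exact (hθ ⟨ψ y x, _⟩).symm

theorem map_grMap_mem_polyFun {T : Type} [AddCommGroup T] [Module (ZMod p) T]
    (hP : ∀ i, IsOpen (descPCentral p P i : Set P))
    (ψ : (σ → ZMod p) → P →ₜ* Q) (h : polySubgroup p 0 1 ψ = ⊤) (i j : ℕ)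
    (a : Gr p P (i + 1, j) ⊗[ZMod p] T) :
    (fun y => TensorProduct.map (grMap (i + 1, j) (ψ y)) LinearMap.id a) ∈
      polyFun (ZMod p) σ (Gr p Q (i + 1, j) ⊗[ZMod p] T) (2 ^ i) := by
  induction a using TensorProduct.induction_on with
  | zero => simpa using const_mem_polyFun _ _
  | tmul e t =>
    exact comp_mem_polyFun ((TensorProduct.mk (ZMod p) _ T).flip t)
      (grMap_mem_polyFun hP ψ h i j e)
  | add a b ha hb =>
    simp only [map_add]
    exact add_mem ha hb

end Poly

/-! ## One-chains modulo boundaries -/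

section Chains

open groupHomology

variable {p : ℕ} [Fact p.Prime] {Q : Type} [Group Q] [TopologicalSpace Q] [IsTopologicalGroup Q]
  {H : Type} [Group H] (A : Rep.{0} (ZMod p) H)

/-- One-chains modulo one-boundaries. -/
abbrev ChainsQuot : Type := (H →₀ A) ⧸ boundaries₁ A

variable {A}

/-- This is the boundary of the two-chain `(g, h) ⊗ a`. When `g` acts trivially it makes the class
additive in the group variable. -/
theorem mkQ_single_mul (g h : H) (a : A) :
    (boundaries₁ A).mkQ (Finsupp.single (g * h) a) =
      (boundaries₁ A).mkQ (Finsupp.single h (A.ρ g⁻¹ a)) +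
      (boundaries₁ A).mkQ (Finsupp.single g a) := by
  rw [← map_add, ← sub_eq_zero, ← map_sub, Submodule.mkQ_apply, Submodule.Quotient.mk_eq_zero,
    ← neg_mem_iff]
  refine ⟨Finsupp.single (g, h) a, (d₂₁_single (g, h) a).trans ?_⟩
  abel

/-- The class of the chain `φ(q) ⊗ a`, if `φ(Q)` acts trivially. -/
noncomputable def singleHom (φ : Q →* H) (hφ : ∀ q, A.ρ (φ q) = 1) :
    Q →* Multiplicative (A →+ ChainsQuot A) where
  toFun q := Multiplicative.ofAdd
    (((boundaries₁ A).mkQ.comp (Finsupp.lsingle (φ q))).toAddMonoidHom)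
  map_one' := by
    refine congrArg Multiplicative.ofAdd (AddMonoidHom.ext fun a => ?_)
    have h := mkQ_single_mul (A := A) 1 1 a
    simp only [mul_one, inv_one, map_one, Module.End.one_apply, left_eq_add] at h
    simpa using h
  map_mul' q q' := by
    rw [← ofAdd_add]
    refine congrArg Multiplicative.ofAdd (AddMonoidHom.ext fun a => ?_)
    have h := mkQ_single_mul (A := A) (φ q) (φ q') a
    rw [← map_inv φ, hφ, Module.End.one_apply, add_comm] at h
    simpa using h

/-- The pairing `Q / Q² × A → C₁ / B₁`, `(q, a) ↦ φ(q) ⊗ a`. -/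
noncomputable def singlePairing (φ : Q →* H) (hφ : ∀ q, A.ρ (φ q) = 1)
    (hker : IsOpen (φ.ker : Set Q)) : PGr p Q 0 →+ A →+ ChainsQuot A :=
  PGr.lift ((singleHom φ hφ).comp (Subgroup.subtype _)) fun x hx =>
    descPCentral_two_le_ker (p := p) (fun w => by
      refine AddMonoidHom.ext fun a => ?_
      rw [AddMonoidHom.nsmul_apply, ← Nat.cast_smul_eq_nsmul (ZMod p), CharP.cast_eq_zero,
        zero_smul, AddMonoidHom.zero_apply]) (singleHom φ hφ)
      -- The kernel of `singleHom φ hφ` contains the open subgroup `φ.ker`, hence is open and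
      -- closed, as needed to kill the closed subgroup `Q²`.
      (Subgroup.isClosed_of_isOpen _ (Subgroup.isOpen_mono (fun q hq => by
        rw [MonoidHom.mem_ker] at hq ⊢
        rw [← map_one (singleHom φ hφ)]
        simp [singleHom, hq]) hker)) hx

theorem mkQ_single_mem_polyFun {σ : Type*} (φ : Q →* H) (hφ : ∀ q, A.ρ (φ q) = 1)
    (hker : IsOpen (φ.ker : Set Q)) {q : (σ → ZMod p) → Q} {d : ℕ}
    (hq : (fun y => PGr.cls 0 (q y) (mem_descPCentral_one (p := p) _)) ∈ polyFun (ZMod p) σ _ 1)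
    {a : (σ → ZMod p) → A} (ha : a ∈ polyFun (ZMod p) σ A d) (h : H) :
    (fun y => (boundaries₁ A).mkQ (Finsupp.single (φ (q y) * h) (a y))) ∈
      polyFun (ZMod p) σ (ChainsQuot A) (d + 1) := by
  simp only [mkQ_single_mul, ← map_inv φ, hφ, Module.End.one_apply]
  refine (polyFun (ZMod p) σ (ChainsQuot A) (d + 1)).add_mem ?_ ?_
  · exact polyFun_mono (Nat.le_succ d)
      (comp_mem_polyFun ((boundaries₁ A).mkQ ∘ₗ Finsupp.lsingle h) ha)
  · rw [add_comm d]
    exact comp_add_mem_polyFun (singlePairing φ hφ hker) hq ha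

end Chains

/-! ## Killing homology classes by polynomial families -/

section Kill

open groupHomology

variable {p : ℕ} [Fact p.Prime] {HP HQ : Type} [Group HP] [Group HQ]
  {A : Rep.{0} (ZMod p) HP} {B : Rep.{0} (ZMod p) HQ}

/-- By linearity a single chain `s ⊗ a` suffices. Hypothesis `hF` confines the dependence of `F y s`
on `y` to the trivially acting factor `φ (ψ y x)`; the fixed factor `h` absorbs the `G`-component.
-/
theorem chainsMap₁_mem_polyFun {P Q : Type} [Group P] [TopologicalSpace P] [IsTopologicalGroup P]
    [Group Q] [TopologicalSpace Q] [IsTopologicalGroup Q] {σ : Type*}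
    (ψ : (σ → ZMod p) → P →ₜ* Q) (hψ : polySubgroup p 0 1 ψ = ⊤)
    (φ : Q →* HQ) (hφ : ∀ q, B.ρ (φ q) = 1) (hker : IsOpen (φ.ker : Set Q))
    (F : (σ → ZMod p) → HP →* HQ) (hF : ∀ s, ∃ (x : P) (h : HQ), ∀ y, F y s = φ (ψ y x) * h)
    (Φ : ∀ y, A ⟶ Rep.res (F y) B) {d : ℕ}
    (hΦ : ∀ a : A, (fun y => ((Φ y).hom a : B)) ∈ polyFun (ZMod p) σ B d) (z : HP →₀ A) :
    (fun y => (boundaries₁ B).mkQ ((chainsMap₁ (F y) (Φ y)).hom z)) ∈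
      polyFun (ZMod p) σ (ChainsQuot B) (d + 1) := by
  induction z using Finsupp.induction_linear with
  | zero => simpa using const_mem_polyFun (0 : ChainsQuot B) (d + 1)
  | add z w hz hw =>
    simp only [map_add]
    exact add_mem hz hw
  | single s a =>
    obtain ⟨x, h, hs⟩ := hF s
    obtain ⟨hx, hxp⟩ : x ∈ polySubgroup p 0 1 ψ := hψ ▸ Subgroup.mem_top x
    convert mkQ_single_mem_polyFun φ hφ hker hxp (hΦ a) h using 3 with y
    rw [← hs y]
    simp [chainsMap₁]

/-- If a family of maps on chains is polynomial in each block of variables and vanishes at the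
origin, then some member with all blocks nonzero kills given classes in first homology. -/
theorem exists_map_eq_zero [Finite HQ] [Module.Finite (ZMod p) B] {n N d t : ℕ}
    (F : (Fin n → Fin N → ZMod p) → HP →* HQ) (Φ : ∀ c, A ⟶ Rep.res (F c) B)
    (hpoly : ∀ z c b, (fun y => (boundaries₁ B).mkQ ((chainsMap₁ (F (Function.update c b y))
      (Φ (Function.update c b y))).hom z)) ∈ polyFun (ZMod p) (Fin N) (ChainsQuot B) d)
    (h0 : ∀ a : A, ((Φ 0).hom a : B) = 0)
    (hN : t * Module.finrank (ZMod p) (ChainsQuot B) * d < N)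
    (x : Fin t → groupHomology A 1) :
    ∃ c : Fin n → Fin N → ZMod p, (∀ b, c b ≠ 0) ∧ ∀ α, map (F c) (Φ c) 1 (x α) = 0 := by
  have hx : ∀ α, ∃ z : cycles₁ A, H1π A z = x α := fun α => by
    induction x α using H1_induction_on with
    | h z => exact ⟨z, rfl⟩
  choose z hz using hx
  obtain ⟨c, hc, hcz⟩ := exists_common_zero (by simpa using hN)
    (fun α c => (boundaries₁ B).mkQ ((chainsMap₁ (F c) (Φ c)).hom (z α).1))
    (fun α => hpoly (z α).1) fun α => by
      have : (chainsMap₁ (F 0) (Φ 0)).hom = 0 := by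
        refine Finsupp.lhom_ext fun s a => ?_
        simp [chainsMap₁, h0]
      rw [this, LinearMap.zero_apply, map_zero]
  refine ⟨c, hc, fun α => ?_⟩
  rw [← hz, H1π_comp_map_apply, H1π_eq_zero_iff, coe_mapCycles₁]
  -- Vanishing modulo boundaries is exactly vanishing in homology, since the image of a cycle is a
  -- cycle.
  exact (Submodule.Quotient.mk_eq_zero _).1 (hcz α)

end Kill

/-! ## The operator homomorphisms `x_{a,g} ↦ x_{b,g}ᶜ` -/

section OpHom

variable {p : ℕ} {G : Type} {m n N : ℕ}

/-- The images `x_{b,g} ^ c(b,k)` of the generators `x_{a,g}`, where `β a = (b, k)`; generators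
with `β a = none` are sent to `1`. -/
def opWord (β : Fin m → Option (Fin n × Fin N)) (c : Fin n → Fin N → ZMod p) (a : Fin m × G) :
    FreeGroup (Fin n × G) :=
  (β a.1).elim 1 fun b => FreeGroup.of (b.1, a.2) ^ (c b.1 b.2).val

variable [Fact p.Prime] (β : Fin m → Option (Fin n × Fin N))

/-- The homomorphism of free pro-`p` groups with `x_{a,g} ↦ x_{b,g} ^ c(b,k)`, `β a = (b, k)`. -/
def opHom (c : Fin n → Fin N → ZMod p) : FreeProPOp p G m →ₜ* FreeProPOp p G n :=
  ProPCompletion.map (FreeGroup.lift (opWord β c))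

theorem opHom_smul [Group G] (c : Fin n → Fin N → ZMod p) (g : G) (x : FreeProPOp p G m) :
    opHom β c (g • x) = g • opHom β c x := by
  refine (ProPCompletion.map_comp_apply (FreeGroup.lift (opWord β c)) (freeShift m g) x).symm.trans
    (Eq.trans ?_ (ProPCompletion.map_comp_apply (freeShift n g) (FreeGroup.lift (opWord β c)) x))
  congr 2
  refine FreeGroup.ext_hom _ _ fun a => ?_
  simp only [freeShift, MonoidHom.comp_apply, FreeGroup.map.of, FreeGroup.lift_apply_of, opWord]
  rcases β a.1 with _ | b <;> simp

theorem opHom_zero (x : FreeProPOp p G m) : opHom β (0 : Fin n → Fin N → ZMod p) x = 1 := by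
  have h : FreeGroup.lift (opWord (G := G) β (0 : Fin n → Fin N → ZMod p)) = 1 := by
    refine FreeGroup.ext_hom _ _ fun a => ?_
    rw [FreeGroup.lift_apply_of, opWord]
    rcases β a.1 with _ | b <;> simp
  refine ProPCompletion.ext fun M => ?_
  change ProPCompletion.proj M (ProPCompletion.map (FreeGroup.lift (opWord β 0)) x) = 1
  rw [h]
  refine (ProPCompletion.proj_map 1 M x).trans ?_
  obtain ⟨y, hy⟩ := QuotientGroup.mk_surjective (ProPCompletion.proj (M.comap 1) x)
  rw [← hy]
  rfl

theorem opHom_surjective (hβ : ∀ b, ∃ a, β a = some b) (c : Fin n → Fin N → ZMod p)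
    (hc : ∀ b, c b ≠ 0) :
    Function.Surjective (opHom β c : FreeProPOp p G m →ₜ* FreeProPOp p G n) := by
  refine ProPCompletion.map_surjective _ fun M y => ?_
  let f : FreeGroup (Fin m × G) →* FreeGroup (Fin n × G) ⧸ M.1 :=
    (QuotientGroup.mk' M.1).comp (FreeGroup.lift (opWord β c))
  suffices h : ∀ y : FreeGroup (Fin n × G), (y : FreeGroup (Fin n × G) ⧸ M.1) ∈ f.range from h y
  intro y
  induction y using FreeGroup.induction_on with
  | C1 => exact one_mem _
  | mul x y hx hy => exact mul_mem hx hy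
  | inv_of x hx => exact inv_mem hx
  | of b =>
    obtain ⟨b, g⟩ := b
    obtain ⟨k, hk⟩ := Function.ne_iff.1 (hc b)
    obtain ⟨a, ha⟩ := hβ (b, k)
    obtain ⟨l, hl⟩ := M.2.2
    -- A nonzero coordinate `c b k` has a representative prime to `p`, so modulo `M` the generator
    -- is a power of its `c b k`-th power, which is in the image.
    have hcop : (c b k).val.Coprime
        (orderOf (FreeGroup.of (b, g) : FreeGroup (Fin n × G) ⧸ M.1)) := by
      refine Nat.Coprime.coprime_dvd_right (orderOf_dvd_natCard _) ?_
      rw [← Subgroup.index_eq_card, hl]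
      refine Nat.Coprime.pow_right l ((Nat.Prime.coprime_iff_not_dvd Fact.out).2 fun h => ?_).symm
      exact hk ((ZMod.val_eq_zero _).1 (Nat.eq_zero_of_dvd_of_lt h (ZMod.val_lt _)))
    obtain ⟨r, hr⟩ := exists_pow_eq_self_of_coprime hcop
    refine ⟨FreeGroup.of (a, g) ^ r, ?_⟩
    rw [map_pow, ← hr]
    congr 1
    change QuotientGroup.mk (FreeGroup.lift (opWord β c) (FreeGroup.of (a, g))) = _
    rw [FreeGroup.lift_apply_of, opWord, ha]
    rfl

theorem ProPCompletion.eq_top_of_isClosed {Γ : Type} [Group Γ]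
    {C : Subgroup (ProPCompletion p Γ)} (hC : IsClosed (C : Set (ProPCompletion p Γ)))
    (h : ∀ γ, of γ ∈ C) : C = ⊤ := by
  refine top_le_iff.1 (le_trans (fun x _ => ?_)
    (ker_proj_le hC ⟨⊤, inferInstance, 0, by simp⟩ fun γ _ => h γ))
  obtain ⟨γ, hγ⟩ := QuotientGroup.mk_surjective
    (ProPCompletion.proj (⟨⊤, inferInstance, 0, by simp⟩ : PIndexSubgroup p Γ) x)
  rw [MonoidHom.mem_ker, ← hγ]
  exact (QuotientGroup.eq_one_iff γ).2 (Subgroup.mem_top γ)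

theorem isOpen_descPCentral_freeProPOp [Finite G] (m i : ℕ) :
    IsOpen (descPCentral p (FreeProPOp p G m) i : Set (FreeProPOp p G m)) :=
  ProPCompletion.isOpen_descPCentral (Γ := FreeGroup (Fin m × G)) i

/-- The subgroup is closed, so generators of the free group suffice. Modulo `P²`, raising to the
power `y.val` is scalar multiplication by `y`; the class is thus a coordinate times a vector when
the generator belongs to block `b`, and constant otherwise. -/
theorem polySubgroup_opHom [Finite G] (c : Fin n → Fin N → ZMod p) (b : Fin n) :
    polySubgroup p 0 1 (fun y => (opHom β (Function.update c b y) :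
      FreeProPOp p G m →ₜ* FreeProPOp p G n)) = ⊤ := by
  refine ProPCompletion.eq_top_of_isClosed (Γ := FreeGroup (Fin m × G))
    (isClosed_polySubgroup (isOpen_descPCentral_freeProPOp m) 0 1 _) fun γ => ?_
  induction γ using FreeGroup.induction_on with
  | C1 => exact one_mem _
  | mul x y hx hy => exact mul_mem hx hy
  | inv_of x hx => exact inv_mem hx
  | of a =>
    refine ⟨mem_descPCentral_one _, ?_⟩
    obtain ⟨a, g⟩ := a
    have hgen : ∀ c : Fin n → Fin N → ZMod p,
        opHom β c (FreeProPOp.gen a g) = (β a).elim 1 fun b => FreeProPOp.gen b.1 g ^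
          (c b.1 b.2).val := fun c => by
      refine (ProPCompletion.map_of _ _).trans ?_
      rw [FreeGroup.lift_apply_of, opWord]
      rcases β a with _ | b
      · rfl
      · exact map_pow _ _ _
    change (fun y => PGr.cls 0 (opHom β (Function.update c b y) (FreeProPOp.gen a g))
      (mem_descPCentral_one _)) ∈ _
    rcases hβ : β a with _ | ⟨b', k⟩ <;> simp only [hgen, hβ]
    · exact const_mem_polyFun (0 : PGr p (FreeProPOp p G n) 0) 1
    · have h : ∀ y : ZMod p, PGr.cls 0 ((FreeProPOp.gen b' g : FreeProPOp p G n) ^ y.val)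
          (mem_descPCentral_one (p := p) _) =
          y • PGr.cls 0 (FreeProPOp.gen b' g) (mem_descPCentral_one _) := fun y => by
        rw [PGr.cls_pow (mem_descPCentral_one _), ← Nat.cast_smul_eq_nsmul (ZMod p),
          ZMod.natCast_zmod_val]
      simp only [Option.elim_some, h]
      rcases eq_or_ne b' b with rfl | hb
      · simpa using coord_smul_mem_polyFun k _
      · simpa [hb] using const_mem_polyFun _ 1

end OpHom

/-! ### Triviality of the conjugation action and finiteness of the coefficients -/

section Coefficients

variable {p : ℕ} {G : Type} {m n N : ℕ} {T : Type} [AddCommGroup T] [Module (ZMod p) T]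

/-- Commutators of `P^(ν)` with `P` already lie in `P^(ν+1)`. This triviality is what makes chains
additive in the group variable. -/
theorem conjRep_eq_one {P : Type} [Group P] [TopologicalSpace P] [IsTopologicalGroup P]
    (ν : ℕ × ℕ) (a : P ⧸ nuFil p P ν) : conjRep p P ν a = 1 := by
  obtain ⟨x, rfl⟩ := QuotientGroup.mk_surjective a
  refine LinearMap.ext fun e => ?_
  obtain ⟨z, rfl⟩ := Gr.mk_surjective ν e
  rw [conjRep_mk, grMap_mk, Module.End.one_apply, Gr.mk_eq_mk]
  have h := commutator_mem_nuFil_succ (p := p) ((nuFil p P ν).inv_mem z.2) x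
  simpa [conjHom_apply, mul_assoc] using inv_mem h

theorem coeffRep_inl [Group G] (τ : Representation (ZMod p) G T) {P : Type} [Group P] [TopologicalSpace P] [IsTopologicalGroup P]
    [MulDistribMulAction G P] [ContinuousConstSMul G P] (ν : ℕ × ℕ) (a : P ⧸ nuFil p P ν) :
    (coeffRep τ P ν).ρ (SemidirectProduct.inl a) = 1 := by
  change TensorProduct.map (conjRep p P ν a ∘ₗ grMap ν (smulHom P (1 : G))) (τ 1) = _
  rw [conjRep_eq_one, grMap_eq_id ν (smulHom P (1 : G)) fun x => by simp [smulHom_apply], map_one]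
  exact TensorProduct.map_id

variable [Fact p.Prime]

theorem isOpen_nuFil [Finite G] (i j : ℕ) :
    IsOpen (nuFil p (FreeProPOp p G m) (i, j) : Set (FreeProPOp p G m)) :=
  Subgroup.isOpen_mono le_sup_right (isOpen_descPCentral_freeProPOp m (i + 1))

instance : CompactSpace (FreeProPOp p G m) :=
  inferInstanceAs (CompactSpace (ProPCompletion p (FreeGroup (Fin m × G))))

theorem finite_quotient_nuFil [Finite G] (i j : ℕ) :
    Finite (FreeProPOp p G m ⧸ nuFil p (FreeProPOp p G m) (i, j)) :=
  Subgroup.quotient_finite_of_isOpen _ (isOpen_nuFil i j)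

theorem finite_gr [Finite G] (ν : ℕ × ℕ) : Finite (Gr p (FreeProPOp p G m) ν) := by
  have : (nuFil p (FreeProPOp p G m) (nuSucc ν)).FiniteIndex :=
    @Subgroup.finiteIndex_of_finite_quotient _ _ _ (finite_quotient_nuFil _ _)
  exact inferInstanceAs (Finite (_ ⧸ (nuFil p (FreeProPOp p G m) (nuSucc ν)).subgroupOf _))

theorem grMap_opHom_zero (β : Fin m → Option (Fin n × Fin N)) (ν : ℕ × ℕ)
    (a : Gr p (FreeProPOp p G m) ν ⊗[ZMod p] T) :
    TensorProduct.map (grMap ν (opHom β 0 : FreeProPOp p G m →ₜ* FreeProPOp p G n))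
      LinearMap.id a = 0 := by
  have h : (grMap ν (opHom β 0) : Gr p (FreeProPOp p G m) ν →ₗ[ZMod p]
      Gr p (FreeProPOp p G n) ν) = 0 := by
    refine LinearMap.ext fun e => ?_
    obtain ⟨z, rfl⟩ := Gr.mk_surjective ν e
    rw [grMap_mk]
    change _ = Gr.mk ν 1
    congr 1
    exact Subtype.ext (opHom_zero β z.1)
  rw [h, TensorProduct.map_zero_left, LinearMap.zero_apply]

end Coefficients

/-! ### Choice of the block size and conclusion -/

theorem proposition7 (p : ℕ) [Fact p.Prime] (G : Type) [Group G] [Finite G] (n t : ℕ)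
    (T : Type) [AddCommGroup T] [Module (ZMod p) T] (τ : Representation (ZMod p) G T)
    (hT : Module.Finite (MonoidAlgebra (ZMod p) G) τ.asModule)
    (i j : ℕ) (hj : 1 ≤ j) (hij : j ≤ i) :
    ∃ m₀ : ℕ, n ≤ m₀ ∧ ∀ m : ℕ, m₀ ≤ m →
      (∀ x : Fin t → groupHomology (coeffRep τ (FreeProPOp p G m) (i, j)) 1,
        ∃ (ψ : FreeProPOp p G m →ₜ* FreeProPOp p G n)
          (hψ : ∀ (g : G) (y : FreeProPOp p G m), ψ (g • y) = g • ψ y),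
          Function.Surjective ψ ∧ ∀ α : Fin t, h1Map τ (i, j) ψ hψ (x α) = 0) ∧
      (∀ x : Fin t → groupHomology (coeffRepQuo τ (FreeProPOp p G m) (i, j)) 1,
        ∃ (ψ : FreeProPOp p G m →ₜ* FreeProPOp p G n)
          (hψ : ∀ (g : G) (y : FreeProPOp p G m), ψ (g • y) = g • ψ y),
          Function.Surjective ψ ∧ ∀ α : Fin t, h1MapQuo τ (i, j) ψ hψ (x α) = 0) := by
  obtain ⟨i, rfl⟩ := Nat.exists_eq_add_of_le' (hj.trans hij)
  let ν := (i + 1, j)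
  let B := coeffRep τ (FreeProPOp p G n) ν
  let B' := coeffRepQuo τ (FreeProPOp p G n) ν
  have : Module.Finite (ZMod p) T :=
    Module.Finite.trans (R := ZMod p) (MonoidAlgebra (ZMod p) G) τ.asModule
  have := finite_gr (p := p) (G := G) (m := n) ν
  have : Module.Finite (ZMod p) (Gr p (FreeProPOp p G n) ν) := Module.Finite.of_finite
  have hB : Module.Finite (ZMod p) B :=
    inferInstanceAs (Module.Finite (ZMod p) (Gr p (FreeProPOp p G n) ν ⊗[ZMod p] T))
  have hB' : Module.Finite (ZMod p) B' := hB
  have := finite_quotient_nuFil (p := p) (G := G) (m := n) (i + 1) j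
  have : Finite (SemiQuo p (FreeProPOp p G n) G ν) :=
    Finite.of_equiv _ SemidirectProduct.equivProd.symm
  -- Each summand is the Chevalley–Warning bound for one of the two statements: `t` cycles, the
  -- dimension of the target, degree `2 ^ i + 1`. The final `1` makes both inequalities strict and
  -- `N` positive, whence `n ≤ n * N`.
  let N := t * Module.finrank (ZMod p) (ChainsQuot B) * (2 ^ i + 1) +
    t * Module.finrank (ZMod p) (ChainsQuot B') * (2 ^ i + 1) + 1
  refine ⟨n * N, Nat.le_mul_of_pos_right n (Nat.succ_pos _), fun m hm => ?_⟩
  obtain ⟨e⟩ : Nonempty (Fin n × Fin N ↪ Fin m) :=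
    Function.Embedding.nonempty_of_card_le (by simpa using hm)
  let β : Fin m → Option (Fin n × Fin N) := Function.partialInv e
  have hβ : ∀ b, ∃ a, β a = some b := fun b => ⟨e b, Function.partialInv_left e.injective b⟩
  let ψ : (Fin n → Fin N → ZMod p) → FreeProPOp p G m →ₜ* FreeProPOp p G n := opHom β
  have hψ : ∀ c (g : G) y, ψ c (g • y) = g • ψ c y := opHom_smul β
  have hopen : ∀ {H : Type} [Group H] (f : FreeProPOp p G n →* H),
      nuFil p (FreeProPOp p G n) ν ≤ f.ker → IsOpen (f.ker : Set (FreeProPOp p G n)) :=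
    fun f hf => Subgroup.isOpen_mono hf (isOpen_nuFil (i + 1) j)
  have hcoeff : ∀ (a : Gr p (FreeProPOp p G m) ν ⊗[ZMod p] T) c b,
      (fun y => TensorProduct.map (grMap ν (ψ (Function.update c b y))) LinearMap.id a) ∈
        polyFun (ZMod p) (Fin N) (Gr p (FreeProPOp p G n) ν ⊗[ZMod p] T) (2 ^ i) := fun a c b =>
    map_grMap_mem_polyFun (isOpen_descPCentral_freeProPOp m) _ (polySubgroup_opHom β c b) i j a
  constructor
  · intro x
    obtain ⟨c, hc, hcx⟩ := exists_map_eq_zero (B := B) (d := 2 ^ i + 1)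
      (fun c => semiMap ν (ψ c) (hψ c)) (fun c => coeffMap τ ν (ψ c) (hψ c))
      (fun z c b => chainsMap₁_mem_polyFun _ (polySubgroup_opHom β c b)
        (SemidirectProduct.inl.comp (QuotientGroup.mk' _)) (fun q => coeffRep_inl τ ν _)
        (hopen _ fun q hq => by
          exact (congrArg SemidirectProduct.inl ((QuotientGroup.eq_one_iff q).2 hq)).trans
            (map_one SemidirectProduct.inl))
        _ (fun ⟨s, g⟩ => by
          obtain ⟨x, rfl⟩ := QuotientGroup.mk_surjective s
          exact ⟨x, SemidirectProduct.inr g, fun y =>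
            (SemidirectProduct.mk_eq_inl_mul_inr _ _)⟩)
        (fun y => coeffMap τ ν (ψ (Function.update c b y)) (hψ _)) (fun a => hcoeff a c b) z)
      (grMap_opHom_zero β ν) (by omega) x
    exact ⟨ψ c, hψ c, opHom_surjective β hβ c hc, hcx⟩
  · intro x
    obtain ⟨c, hc, hcx⟩ := exists_map_eq_zero (B := B') (d := 2 ^ i + 1)
      (fun c => quoMap ν (ψ c)) (fun c => coeffMapQuo τ ν (ψ c) (hψ c))
      (fun z c b => chainsMap₁_mem_polyFun _ (polySubgroup_opHom β c b)
        (QuotientGroup.mk' _) (fun q => coeffRep_inl τ ν _)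
        (hopen _ fun q hq => (QuotientGroup.eq_one_iff q).2 hq)
        _ (fun s => by
          obtain ⟨x, rfl⟩ := QuotientGroup.mk_surjective s
          -- Without the factor `G`, the whole group acts trivially and no fixed factor is needed.
          exact ⟨x, 1, fun y => (mul_one _).symm⟩)
        (fun y => coeffMapQuo τ ν (ψ (Function.update c b y)) (hψ _)) (fun a => hcoeff a c b) z)
      (grMap_opHom_zero β ν) (by omega) x
    exact ⟨ψ c, hψ c, opHom_surjective β hβ c hc, hcx⟩
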